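/- Let $r,\lambda,\delta>0$ and $x^*>0$, and let $G_Z$ be a probability distribution supported in $(0,1)$. Let $0=\tau_0<\tau_1<\tau_2<\cdots$ be such that $(\tau_i)_{i\ge1}$ are the jump times of a Poisson process of intensity $\lambda$, let $(Z_i)_{i\ge1}$ be i.i.d. with distribution $G_Z$ and independent of $(\tau_i)_{i\ge1}$, all on the canonical space of the sequence $(\tau_i,Z_i)_{i\ge 1}$, and let $\mathcal F_t$ be the complete $\sigma$-algebra generated by the pairs $(\tau_i,Z_i)$ with $\tau_i\le t$. For an initial capital $x\ge0$, a strategy is an $(\mathcal F_t)$-adapted, non-decreasing, right-continuous process $S=(S_t)_{t\ge0}$ with $S_{0^-}=0$ ($S_t$ is the cumulative amount of capital transferred up to time $t$). The controlled capital $X^S$ is given by $X^S_0=x+S_0$ and, for $i\ge1$, $$X^S_t=x^*+(X^S_{\tau_{i-1}}-x^*)e^{r(t-\tau_{i-1})}+\int_{(\tau_{i-1},t]}e^{r(t-s)}\,dS_s\quad(\tau_{i-1}\le t<\tau_i),\qquad X^S_{\tau_i}=Z_i\,X^S_{\tau_i^-}+S_{\tau_i}-S_{\tau_i^-}.$$ The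 strategy is admissible, $S\in\Pi_x$, if almost surely $X^S_t\ge x^*$ for all $t\ge0$. The optimal value function is $$V(x)=\inf_{S\in\Pi_x}\mathbb E\Big[\int_{0^-}^\infty e^{-\delta t}\,dS_t\Big],$$ where the integral includes the contribution $S_0$ of a transfer at time $0$. For $u:[x^*,\infty)\to\mathbb R$ and $x>x^*$ put $$\mathcal L(u)(x)=r(x-x^*)u'(x)-(\lambda+\delta)u(x)+\lambda\int_{(0,x^*/x]}\big(u(x^*)+x^*-xz\big)\,dG_Z(z)+\lambda\int_{(x^*/x,1)}u(xz)\,dG_Z(z).$$ A locally Lipschitz function $u:[x^*,\infty)\to\mathbb R$ is a viscosity solution of $$\min\{1+u'(x),\ \mathcal L(u)(x)\}=0\quad\text{on }(x^*,\infty)$$ if for every $x>x^*$ and every continuous $\psi:[x^*,\infty)\to\mathbb R$ that is continuously differentiable on $(x^*,\infty)$ and satisfies $\psi(x)=u(x)$: (i) (subsolution) if $u-\psi$ attains its minimum over $[x^*,\infty)$ at $x$, then $\min\{1+\psi'(x),\mathcal L(\psi)(x)\}\le0$; (ii) (supersolution) if $u-\psi$ attains its maximum over $[x^*,\infty)$ at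 $x$, then $\min\{1+\psi'(x),\mathcal L(\psi)(x)\}\ge0$. Proposition. $V(x)<\infty$ for every $x\ge0$, and $V$ restricted to $[x^*,\infty)$ is a viscosity solution of $\min\{1+u'(x),\mathcal L(u)(x)\}=0$ on $(x^*,\infty)$; in particular, $V$ is locally Lipschitz on $[x^*,\infty)$. -/

import Mathlib

open MeasureTheory Set

noncomputable section

/-- The parameters of the household capital model: growth rate `r`, poverty line `xstar`, intensity
`lam` of the loss events, discount rate `delta`, and law `G` of the remaining proportions `Z`,
a probability measure supported in `(0,1)`. -/
structure CapitalModel where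
  r : ℝ
  xstar : ℝ
  lam : ℝ
  delta : ℝ
  G : Measure ℝ
  r_pos : 0 < r
  xstar_pos : 0 < xstar
  lam_pos : 0 < lam
  delta_pos : 0 < delta
  G_prob : IsProbabilityMeasure G
  G_support : G (Ioo 0 1)ᶜ = 0

/-- A scenario lists, for each `n`, the waiting time between the loss events number `n` and `n + 1`
and the proportion of capital remaining after the loss event number `n + 1` (event number `0` is
time `0`, without a loss). -/
abbrev Scenario := ℕ → ℝ × ℝ

namespace CapitalModel

variable (M : CapitalModel)

instance instProbG : IsProbabilityMeasure M.G := M.G_prob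

instance instProbExp : IsProbabilityMeasure (ProbabilityTheory.expMeasure M.lam) :=
  ProbabilityTheory.isProbabilityMeasure_expMeasure M.lam_pos

/-- The probability measure on scenarios: the waiting times are i.i.d. exponential with parameter
`lam` (so that the events form a Poisson process of intensity `lam`), the remaining proportions are
i.i.d. with law `G`, and the two sequences are independent. Almost surely the arrival times increase
strictly to infinity and all the proportions lie in `(0,1)`. -/
def prob : Measure Scenario :=
  Measure.infinitePi fun _ : ℕ => (ProbabilityTheory.expMeasure M.lam).prod M.G

/-- `arrival n ω` is the time `τ n` of the loss event number `n`, with `τ 0 = 0`. -/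
def arrival (n : ℕ) (ω : Scenario) : ℝ := ∑ i ∈ Finset.range n, (ω i).1

/-- `proportion n ω` is the proportion of capital remaining after event number `n + 1`. -/
def proportion (n : ℕ) (ω : Scenario) : ℝ := (ω n).2

/-- The number of loss events up to time `t`. -/
def count (t : ℝ) (ω : Scenario) : ℕ := {n : ℕ | arrival (n + 1) ω ≤ t}.ncard

/-- The σ-algebra generated by the arrival times and proportions of the events up to time `t`. -/
@[reducible] def rawHistory (t : ℝ) : MeasurableSpace Scenario :=
  MeasurableSpace.generateFrom
    {s | ∃ (n : ℕ) (A : Set (ℝ × ℝ)), MeasurableSet A ∧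
      s = {ω | arrival (n + 1) ω ≤ t ∧ (arrival (n + 1) ω, proportion n ω) ∈ A}}

/-- The history up to time `t`, completed by all the null sets of `prob`: its members are the sets
that agree, outside a null set, with a member of `rawHistory t`. -/
@[reducible] def history (t : ℝ) : MeasurableSpace Scenario :=
  eventuallyMeasurableSpace (rawHistory t) (ae M.prob)

/-- The capital at time `t` when no loss event occurs after time `s` up to time `t`, the capital at
time `s` is `y`, and transfers are made according to `S` at the times in `J`, where `J` is `(s, t]`
(capital at time `t`) or `(s, t)` (capital just before time `t`). It is the solution of
`dX = r (X - xstar) dt + dS`. -/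
def flow (S : StieltjesFunction ℝ) (s y t : ℝ) (J : Set ℝ) : ℝ :=
  M.xstar + (y - M.xstar) * Real.exp (M.r * (t - s))
    + ∫ a in J, Real.exp (M.r * (t - a)) ∂S.measure

/-- The controlled capital at the `n`-th arrival time, for the cumulative transfers `S` and initial
capital `x` (before the transfer `S 0` at time `0`). At an event, the capital just before it is
multiplied by the remaining proportion, and then the transfer made at that time is added. -/
def capitalAtArrival (x : ℝ) (S : StieltjesFunction ℝ) (ω : Scenario) : ℕ → ℝ
  | 0 => x + S 0
  | n + 1 =>
      M.flow S (arrival n ω) (capitalAtArrival x S ω n) (arrival (n + 1) ω)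
          (Ioo (arrival n ω) (arrival (n + 1) ω)) * proportion n ω
        + (S (arrival (n + 1) ω) - Function.leftLim S (arrival (n + 1) ω))

/-- The controlled capital at time `t ≥ 0`. -/
def capital (x : ℝ) (S : StieltjesFunction ℝ) (ω : Scenario) (t : ℝ) : ℝ :=
  M.flow S (arrival (count t ω) ω) (M.capitalAtArrival x S ω (count t ω)) t
    (Ioc (arrival (count t ω) ω) t)

/-- Admissible strategies for the initial capital `x`: `S ω t` is the cumulative amount transferred
up to time `t`, non-decreasing and right-continuous in `t` (this is bundled in `StieltjesFunction`),
zero before time `0`, adapted, and such that the controlled capital stays at or above the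
poverty line. -/
structure IsAdmissible (x : ℝ) (S : Scenario → StieltjesFunction ℝ) : Prop where
  zero_of_neg : ∀ ω t, t < 0 → S ω t = 0
  adapted : ∀ t, 0 ≤ t → Measurable[M.history t] fun ω => S ω t
  above : ∀ᵐ ω ∂M.prob, ∀ t, 0 ≤ t → M.xstar ≤ M.capital x (S ω) ω t

/-- The expected discounted transfers `E ∫ exp (-δ t) dS`. A transfer at time `0` counts: the
Stieltjes measure has the atom `S 0` at `0`, and no mass before time `0`. -/
def cost (S : Scenario → StieltjesFunction ℝ) : ENNReal :=
  ∫⁻ ω, ∫⁻ t, ENNReal.ofReal (Real.exp (-M.delta * t)) ∂(S ω).measure ∂M.prob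

/-- The optimal value function, with values in `[0, ∞]`. -/
def value (x : ℝ) : ENNReal := ⨅ S : {S // M.IsAdmissible x S}, M.cost S.1

/-- The discounted generator, with the capital brought back to `xstar` (at a cost equal to the
amount injected) when a loss event takes it below `xstar`. It only involves the values of `u` on
`[xstar, ∞)` when `x > xstar`. -/
def generator (u : ℝ → ℝ) (x : ℝ) : ℝ :=
  M.r * (x - M.xstar) * deriv u x - (M.lam + M.delta) * u x
    + M.lam * ∫ z in Ioc 0 (M.xstar / x), (u M.xstar + M.xstar - x * z) ∂M.G
    + M.lam * ∫ z in Ioc (M.xstar / x) 1, u (x * z) ∂M.G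

/-- Test functions: continuous on `[xstar, ∞)` and continuously differentiable on
`(xstar, ∞)`. -/
def IsTestFunction (f : ℝ → ℝ) : Prop :=
  ContinuousOn f (Ici M.xstar) ∧ ContDiffOn ℝ 1 f (Ioi M.xstar)

/-- Viscosity subsolutions at `x` of `min {1 + u', L u} = 0`. -/
def IsViscositySubsolutionAt (u : ℝ → ℝ) (x : ℝ) : Prop :=
  LocallyLipschitzOn (Ici M.xstar) u ∧
    ∀ ψ : ℝ → ℝ, M.IsTestFunction ψ → ψ x = u x →
      IsMinOn (fun y => u y - ψ y) (Ici M.xstar) x →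
      min (1 + deriv ψ x) (M.generator ψ x) ≤ 0

/-- Viscosity supersolutions at `x` of `min {1 + u', L u} = 0`. -/
def IsViscositySupersolutionAt (u : ℝ → ℝ) (x : ℝ) : Prop :=
  LocallyLipschitzOn (Ici M.xstar) u ∧
    ∀ φ : ℝ → ℝ, M.IsTestFunction φ → φ x = u x →
      IsMaxOn (fun y => u y - φ y) (Ici M.xstar) x →
      0 ≤ min (1 + deriv φ x) (M.generator φ x)

/-- Viscosity solutions of `min {1 + u', L u} = 0` on `(xstar, ∞)`. -/
def IsViscositySolution (u : ℝ → ℝ) : Prop :=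
  LocallyLipschitzOn (Ici M.xstar) u ∧
    ∀ x, M.xstar < x → M.IsViscositySubsolutionAt u x ∧ M.IsViscositySupersolutionAt u x

end CapitalModel

end

/-!
The proof reduces the control problem to a deterministic one between two loss events, and identifies
the value function with the fixed point of the Bellman operator of the first event.

Before the first event an adapted strategy is deterministic, and a deterministic strategy is encoded
by the measure `m` of its transfers (`IsControl`). Starting from `y`, it costs
`stepCost f y m = E [∫_{[0, τ)} exp (-δ t) dm + exp (-δ τ) f (Z X_{τ-})]` up to the first event, if
`f` is the cost to be paid from then on, and `bellman f y` is the infimum over `m`, subject only to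
bringing the capital to the poverty line at time `0`, since afterwards the capital grows until the
next loss. This operator is monotone and, because of the discount, a contraction with factor
`λ / (λ + δ)`. The limit `bellmanValue` of its iterates from `0` is therefore a fixed point
(`bellman_bellmanValue`), bounded on `[0, ∞)`. It is nonincreasing, and since a transfer of `c` may be
made at once, `U = bellmanValue` satisfies `U y ≤ c + U (y + c)`: it is `1`-Lipschitz.

The value function is `bellmanValue` (`value_eq_bellmanValue`). For the lower bound, off a null set an
admissible strategy depends up to the next event only on the past events, so that its continuation
after an event is a control for the deterministic problem; by induction on the events its cost is at
least every iterate of the Bellman operator (`valueIter_le_cost`). The induction conditions on the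
past by means of `splice`: replacing the events from number `n` on by those of an independent scenario
does not change the law. For the upper bound, the feedback strategy that follows after each event an
`ε`-optimal control, chosen from a countable list according to the cell of the capital, is admissible
and costs at most `ε` more, up to a constant factor (`value_le_of_feedback`).

The lack of memory of the exponential law turns the Bellman equation into a dynamic programming
identity at any deterministic time `h` (`stepCost_split`). Waiting until time `h` gives an upper
bound for `U`, and its derivative at `h = 0` is the supersolution property of the generator. For the
subsolution property, the cost of any control is bounded below by an explicit function of `h` and of
the capital `a ≥ 0` that the transfers before `h` have added at time `h` (`le_stepCost`). If both
`1 + ψ'` and the generator of `ψ` were positive at `x`, this function would exceed `U x` by a positive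
amount for one small `h` and all `a`, which contradicts the Bellman equation.
-/

noncomputable section

open Filter Topology ProbabilityTheory
open scoped ENNReal

/-! ### Deterministic controls and discounted transfers -/

/-- The transfers prescribed by the measure `m` on `[0, w)`, discounted at rate `k`. -/
def discMass (k : ℝ) (m : Measure ℝ) (w : ℝ) : ℝ≥0∞ :=
  ∫⁻ a in Ico 0 w, ENNReal.ofReal (Real.exp (-k * a)) ∂m

/-- The part of `m` on `[h, ∞)`, with the time origin moved to `h`. -/
def shiftMeasure (h : ℝ) (m : Measure ℝ) : Measure ℝ :=
  (m.restrict (Ici h)).map fun a => a - h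

/-- Deterministic controls, encoded by the measure of the transfers: no transfer before time `0`,
and a finite amount over bounded periods. -/
structure IsControl (m : Measure ℝ) : Prop where
  neg : m (Iio 0) = 0
  fin : ∀ t, m (Iic t) ≠ ∞

lemma discMass_mono (k : ℝ) (m : Measure ℝ) : Monotone (discMass k m) := fun _ _ h =>
  lintegral_mono_set (Ico_subset_Ico_right h)

lemma measurable_discMass (k : ℝ) (m : Measure ℝ) : Measurable (discMass k m) :=
  (discMass_mono k m).measurable

lemma measurable_ofReal_exp (k : ℝ) : Measurable fun a : ℝ => ENNReal.ofReal (Real.exp (-k * a)) :=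
  by fun_prop

lemma discMass_shiftMeasure (k : ℝ) (m : Measure ℝ) (h w : ℝ) :
    discMass k (shiftMeasure h m) w
      = ∫⁻ a in Ico h (h + w), ENNReal.ofReal (Real.exp (-k * (a - h))) ∂m := by
  unfold discMass shiftMeasure
  rw [← lintegral_indicator measurableSet_Ico,
    lintegral_map ((measurable_ofReal_exp k).indicator measurableSet_Ico) (by fun_prop),
    ← lintegral_indicator measurableSet_Ici, ← lintegral_indicator measurableSet_Ico]
  congr 1; ext a
  simp only [indicator, mem_Ici, mem_Ico]
  split_ifs <;> first | rfl | (exfalso; grind)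

/-- Transfers after time `h` are discounted as if time started at `h`, up to the factor `exp (-k h)`. -/
lemma discMass_add_apply (k : ℝ) (m : Measure ℝ) {h w : ℝ} (hh : 0 ≤ h) (hw : 0 ≤ w) :
    discMass k m (h + w) = discMass k m h
      + ENNReal.ofReal (Real.exp (-k * h)) * discMass k (shiftMeasure h m) w := by
  rw [discMass_shiftMeasure, ← lintegral_const_mul _ (by fun_prop)]
  have h2 : ∀ a : ℝ, ENNReal.ofReal (Real.exp (-k * h)) * ENNReal.ofReal (Real.exp (-k * (a - h)))
      = ENNReal.ofReal (Real.exp (-k * a)) := fun a => by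
    rw [← ENNReal.ofReal_mul (Real.exp_pos _).le, ← Real.exp_add]; ring_nf
  simp only [h2]
  unfold discMass
  rw [← lintegral_union measurableSet_Ico (by
    rw [Set.disjoint_left]; intro a; simp only [mem_Ico]; grind),
    Ico_union_Ico_eq_Ico hh (by linarith)]

lemma discMass_congr {k : ℝ} {m m' : Measure ℝ} {T w : ℝ}
    (h : m.restrict (Iio T) = m'.restrict (Iio T)) (hw : w ≤ T) :
    discMass k m w = discMass k m' w := by
  have : ∀ μ : Measure ℝ, discMass k μ w
      = ∫⁻ a in Ico 0 w, ENNReal.ofReal (Real.exp (-k * a)) ∂(μ.restrict (Iio T)) := fun μ => by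
    rw [Measure.restrict_restrict measurableSet_Ico, inter_eq_left.2]
    · rfl
    · exact fun a ha => lt_of_lt_of_le ha.2 hw
  rw [this, this, h]

lemma discMass_add_measure (k : ℝ) (m m' : Measure ℝ) (w : ℝ) :
    discMass k (m + m') w = discMass k m w + discMass k m' w := by
  simp [discMass]

lemma discMass_dirac (k : ℝ) (c : ℝ≥0∞) {w : ℝ} (hw : 0 < w) :
    discMass k (c • Measure.dirac 0) w = c := by
  simp only [discMass, Measure.restrict_smul, lintegral_smul_measure]
  rw [restrict_dirac' measurableSet_Ico, if_pos ⟨le_rfl, hw⟩, lintegral_dirac]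
  simp

lemma discMass_le_measure {k : ℝ} (hk : 0 ≤ k) (m : Measure ℝ) (w : ℝ) :
    discMass k m w ≤ m (Ico 0 w) := by
  rw [← setLIntegral_one]
  refine setLIntegral_mono' measurableSet_Ico fun a ha => ?_
  rw [← ENNReal.ofReal_one]
  exact ENNReal.ofReal_le_ofReal (Real.exp_le_one_iff.2 (by nlinarith [ha.1]))

lemma singleton_le_discMass (k : ℝ) (m : Measure ℝ) {w : ℝ} (hw : 0 < w) :
    m {0} ≤ discMass k m w := by
  have : ∫⁻ a in {0}, ENNReal.ofReal (Real.exp (-k * a)) ∂m = m {0} := by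
    rw [lintegral_singleton]; simp
  rw [← this]
  exact lintegral_mono_set (singleton_subset_iff.2 ⟨le_rfl, hw⟩)

/-- Changing the discount rate from `r` to `k` costs at most a factor `exp (-k w)` on `[0, w)`. -/
lemma exp_mul_discMass_le {k r : ℝ} (hk : 0 ≤ k) (hr : 0 ≤ r) (m : Measure ℝ) (w : ℝ) :
    ENNReal.ofReal (Real.exp (-k * w)) * discMass r m w ≤ discMass k m w := by
  unfold discMass
  rw [← lintegral_const_mul _ (by fun_prop)]
  refine setLIntegral_mono' measurableSet_Ico fun a ha => ?_
  rw [← ENNReal.ofReal_mul (Real.exp_pos _).le, ← Real.exp_add]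
  exact ENNReal.ofReal_le_ofReal (Real.exp_le_exp.2 (by nlinarith [ha.1, ha.2, mul_nonneg hr ha.1]))

namespace IsControl

variable {m m' : Measure ℝ}

lemma discMass_ne_top (hm : IsControl m) {k : ℝ} (hk : 0 ≤ k) (w : ℝ) : discMass k m w ≠ ∞ :=
  ne_top_of_le_ne_top (hm.fin w) ((discMass_le_measure hk m w).trans
    (measure_mono fun _ ha => ha.2.le))

lemma singleton_ne_top (hm : IsControl m) : m {0} ≠ ∞ :=
  ne_top_of_le_ne_top (hm.fin 0) (measure_mono (by simp))

lemma sFinite (hm : IsControl m) : SFinite m := by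
  have : IsLocallyFiniteMeasure m := ⟨fun x => ⟨Iic (x + 1), Iic_mem_nhds (by linarith),
    (hm.fin _).lt_top⟩⟩
  infer_instance

lemma add (hm : IsControl m) (hm' : IsControl m') : IsControl (m + m') :=
  ⟨by simp [hm.neg, hm'.neg], fun t => by simp [hm.fin t, hm'.fin t]⟩

lemma dirac {c : ℝ≥0∞} (hc : c ≠ ∞) : IsControl (c • Measure.dirac 0) := by
  refine ⟨by simp, fun t => ?_⟩
  simp only [Measure.smul_apply, smul_eq_mul]
  exact ENNReal.mul_ne_top hc (measure_ne_top _ _)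

lemma mono (hm : IsControl m) (h : m' ≤ m) : IsControl m' :=
  ⟨nonpos_iff_eq_zero.1 ((h _).trans hm.neg.le), fun t => ne_top_of_le_ne_top (hm.fin t) (h _)⟩

lemma shift (hm : IsControl m) (h : ℝ) : IsControl (shiftMeasure h m) := by
  constructor
  · rw [shiftMeasure, Measure.map_apply (by fun_prop) measurableSet_Iio,
      Measure.restrict_apply (measurableSet_Iio.preimage (by fun_prop))]
    convert measure_empty (μ := m)
    ext a; simp
  · intro t
    rw [shiftMeasure, Measure.map_apply (by fun_prop) measurableSet_Iic,
      Measure.restrict_apply (measurableSet_Iic.preimage (by fun_prop))]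
    refine ne_top_of_le_ne_top (hm.fin (t + h)) (measure_mono fun a ha => ?_)
    have := ha.1
    simp only [mem_preimage, mem_Iic] at this ⊢
    linarith

lemma zero : IsControl (0 : Measure ℝ) := ⟨by simp, by simp⟩

end IsControl

lemma shiftMeasure_singleton (h : ℝ) (m : Measure ℝ) : shiftMeasure h m {0} = m {h} := by
  rw [shiftMeasure, Measure.map_apply (by fun_prop) (measurableSet_singleton _),
    Measure.restrict_apply ((measurableSet_singleton _).preimage (by fun_prop))]
  congr 1; ext a
  simp only [mem_inter_iff, mem_preimage, mem_singleton_iff, mem_Ici]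
  constructor
  · rintro ⟨h1, -⟩; linarith
  · rintro rfl; simp

/-- The control that waits until time `h ≥ 0` and then follows `m`. -/
def delayMeasure (h : ℝ) (m : Measure ℝ) : Measure ℝ := m.map fun a => a + h

lemma IsControl.delay {m : Measure ℝ} (hm : IsControl m) {h : ℝ} (hh : 0 ≤ h) :
    IsControl (delayMeasure h m) := by
  constructor
  · rw [delayMeasure, Measure.map_apply (by fun_prop) measurableSet_Iio]
    refine measure_mono_null (fun a ha => ?_) hm.neg
    simp only [mem_preimage, mem_Iio] at ha ⊢; linarith
  · intro t
    rw [delayMeasure, Measure.map_apply (by fun_prop) measurableSet_Iic]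
    refine ne_top_of_le_ne_top (hm.fin t) (measure_mono fun a ha => ?_)
    simp only [mem_preimage, mem_Iic] at ha ⊢; linarith

lemma shiftMeasure_delayMeasure {m : Measure ℝ} (hm : IsControl m) (h : ℝ) :
    shiftMeasure h (delayMeasure h m) = m := by
  rw [shiftMeasure, delayMeasure, Measure.restrict_map (by fun_prop) measurableSet_Ici,
    Measure.map_map (by fun_prop) (by fun_prop)]
  have : (fun a : ℝ => a - h) ∘ (fun a => a + h) = id := by ext; simp
  rw [this, Measure.map_id]
  refine Measure.restrict_eq_self_of_ae_mem ?_
  rw [ae_iff]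
  refine measure_mono_null (fun a ha => ?_) hm.neg
  simp at ha ⊢; linarith

lemma discMass_delayMeasure {m : Measure ℝ} (hm : IsControl m) (k : ℝ) {h w : ℝ} (hw : w ≤ h) :
    discMass k (delayMeasure h m) w = 0 := by
  have : delayMeasure h m (Ico 0 w) = 0 := by
    rw [delayMeasure, Measure.map_apply (by fun_prop) measurableSet_Ico]
    refine measure_mono_null (fun a ha => ?_) hm.neg
    simp only [mem_preimage, mem_Ico, mem_Iio] at ha ⊢; linarith
  exact setLIntegral_measure_zero _ _ this

namespace CapitalModel

variable (M : CapitalModel)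

/-- The capital just before time `w` when no loss occurs before, starting from the capital `y`
before any transfer and following the control `m`. -/
def preLoss (y : ℝ) (m : Measure ℝ) (w : ℝ) : ℝ :=
  M.xstar + Real.exp (M.r * w) * (y - M.xstar + (discMass M.r m w).toReal)

lemma preLoss_congr {m m' : Measure ℝ} {T w : ℝ} (y : ℝ)
    (h : m.restrict (Iio T) = m'.restrict (Iio T)) (hw : w ≤ T) :
    M.preLoss y m w = M.preLoss y m' w := by
  rw [preLoss, preLoss, discMass_congr h hw]

/-- The flow property of the capital between two losses. -/
lemma preLoss_add {m : Measure ℝ} (hm : IsControl m) (y : ℝ) {h w : ℝ} (hh : 0 ≤ h) (hw : 0 ≤ w) :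
    M.preLoss y m (h + w) = M.preLoss (M.preLoss y m h) (shiftMeasure h m) w := by
  simp only [preLoss]
  rw [discMass_add_apply _ _ hh hw, ENNReal.toReal_add (hm.discMass_ne_top M.r_pos.le _)
    (ENNReal.mul_ne_top ENNReal.ofReal_ne_top ((hm.shift h).discMass_ne_top M.r_pos.le _)),
    ENNReal.toReal_mul, ENNReal.toReal_ofReal (Real.exp_pos _).le, mul_add M.r, Real.exp_add,
    neg_mul, Real.exp_neg]
  have := (Real.exp_pos (M.r * h)).ne'
  field_simp
  ring

lemma measurable_preLoss (y : ℝ) (m : Measure ℝ) : Measurable (M.preLoss y m) := by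
  have := measurable_discMass M.r m
  unfold preLoss
  fun_prop

lemma preLoss_mono_left {y y' : ℝ} (h : y ≤ y') (m : Measure ℝ) (w : ℝ) :
    M.preLoss y m w ≤ M.preLoss y' m w := by
  unfold preLoss
  gcongr

/-- Strict positivity of `w` matters: the transfer at time `0` is not counted at `w = 0`. -/
lemma xstar_le_preLoss {y : ℝ} {m : Measure ℝ} (hm : IsControl m)
    (h : M.xstar ≤ y + (m {0}).toReal) {w : ℝ} (hw : 0 < w) : M.xstar ≤ M.preLoss y m w := by
  have h1 := ENNReal.toReal_mono (hm.discMass_ne_top M.r_pos.le w) (singleton_le_discMass M.r m hw)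
  unfold preLoss
  have := mul_nonneg (Real.exp_pos (M.r * w)).le
    (by linarith : 0 ≤ y - M.xstar + (discMass M.r m w).toReal)
  linarith

lemma preLoss_mono_right {y : ℝ} {m : Measure ℝ} (hm : IsControl m) (hy : M.xstar ≤ y) {v w : ℝ}
    (h : v ≤ w) : M.preLoss y m v ≤ M.preLoss y m w := by
  unfold preLoss
  have h1 := ENNReal.toReal_mono (hm.discMass_ne_top M.r_pos.le w) (discMass_mono M.r m h)
  have := M.r_pos
  have h0 : 0 ≤ (discMass M.r m w).toReal := ENNReal.toReal_nonneg
  have h2 : Real.exp (M.r * v) ≤ Real.exp (M.r * w) := Real.exp_le_exp.2 (by nlinarith)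
  have h3 : 0 ≤ y - M.xstar := by linarith
  gcongr

lemma preLoss_add_dirac {m : Measure ℝ} (hm : IsControl m) (y : ℝ) {c : ℝ} (hc : 0 ≤ c) {w : ℝ}
    (hw : 0 < w) : M.preLoss y (m + ENNReal.ofReal c • Measure.dirac 0) w = M.preLoss (y + c) m w := by
  unfold preLoss
  rw [discMass_add_measure, discMass_dirac _ _ hw,
    ENNReal.toReal_add (hm.discMass_ne_top M.r_pos.le w) ENNReal.ofReal_ne_top,
    ENNReal.toReal_ofReal hc]
  ring

end CapitalModel

/-! ### The law of the loss events -/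

namespace CapitalModel

variable (M : CapitalModel)

/-- The law of a waiting time and of the remaining proportion at the loss event that ends it. -/
def eventLaw : Measure (ℝ × ℝ) := (expMeasure M.lam).prod M.G

instance : IsProbabilityMeasure M.eventLaw := by unfold eventLaw; infer_instance

instance : IsProbabilityMeasure M.prob := by
  unfold prob; infer_instance

lemma prob_eq : M.prob = Measure.infinitePi fun _ : ℕ => M.eventLaw := rfl

/-- The scenario with the first `n` events of `ω` and all later events of `ω'`. -/
def splice (n : ℕ) (ω ω' : Scenario) : Scenario := fun i => if i < n then ω i else ω' i

lemma splice_of_lt {n i : ℕ} (h : i < n) (ω ω' : Scenario) : splice n ω ω' i = ω i := by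
  simp [splice, h]

lemma splice_of_le {n i : ℕ} (h : n ≤ i) (ω ω' : Scenario) : splice n ω ω' i = ω' i := by
  simp [splice, not_lt.2 h]

lemma measurable_splice (n : ℕ) : Measurable fun p : Scenario × Scenario => splice n p.1 p.2 := by
  refine measurable_pi_lambda _ fun i => ?_
  by_cases h : i < n
  · simp only [splice, h, if_true]; fun_prop
  · simp only [splice, h, if_false]; fun_prop

/-- The events before and after the event number `n` are independent, and the scenario is
distributed as one that takes them from two independent scenarios. -/
lemma measurePreserving_splice (n : ℕ) :
    MeasurePreserving (fun p : Scenario × Scenario => splice n p.1 p.2) (M.prob.prod M.prob)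
      M.prob := by
  refine ⟨measurable_splice n, ?_⟩
  refine Measure.eq_infinitePi _ fun s t ht => ?_
  rw [Measure.map_apply (measurable_splice n) (MeasurableSet.pi s.countable_toSet fun i _ => ht i)]
  have h1 : (fun p : Scenario × Scenario => splice n p.1 p.2) ⁻¹' (Set.pi s t)
      = (Set.pi (s.filter (· < n)) t) ×ˢ (Set.pi (s.filter (¬ · < n)) t) := by
    ext p
    simp only [mem_preimage, Set.mem_pi, mem_prod, Finset.coe_filter, mem_ofPred_eq, Finset.mem_coe]
    constructor
    · intro h
      refine ⟨fun i hi => ?_, fun i hi => ?_⟩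
      · simpa [splice, hi.2] using h i hi.1
      · simpa [splice, hi.2] using h i hi.1
    · rintro ⟨ha, hb⟩ i hi
      by_cases hn : i < n
      · simpa [splice, hn] using ha i ⟨hi, hn⟩
      · simpa [splice, hn] using hb i ⟨hi, hn⟩
  rw [h1, Measure.prod_prod, prob_eq, Measure.infinitePi_pi _ (fun i _ => ht i),
    Measure.infinitePi_pi _ (fun i _ => ht i), Finset.prod_filter_mul_prod_filter_not]
  rfl

lemma measurePreserving_eval (n : ℕ) :
    MeasurePreserving (fun ω : Scenario => ω n) M.prob M.eventLaw :=
  measurePreserving_eval_infinitePi (fun _ : ℕ => M.eventLaw) n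

lemma lintegral_splice (n : ℕ) {F : Scenario → ℝ≥0∞} (hF : Measurable F) :
    ∫⁻ ω, F ω ∂M.prob = ∫⁻ ω, ∫⁻ ω', F (splice n ω ω') ∂M.prob ∂M.prob := by
  rw [← (M.measurePreserving_splice n).lintegral_comp hF,
    lintegral_prod (fun p : Scenario × Scenario => F (splice n p.1 p.2))
      (hF.comp (measurable_splice n)).aemeasurable]

lemma ae_splice (n : ℕ) {p : Scenario → Prop} (h : ∀ᵐ ω ∂M.prob, p ω) :
    ∀ᵐ ω ∂M.prob, ∀ᵐ ω' ∂M.prob, p (splice n ω ω') :=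
  Measure.ae_ae_of_ae_prod ((M.measurePreserving_splice n).quasiMeasurePreserving.ae h)

lemma lintegral_eval (n : ℕ) {F : ℝ × ℝ → ℝ≥0∞} (hF : Measurable F) :
    ∫⁻ ω, F (ω n) ∂M.prob = ∫⁻ p, F p ∂M.eventLaw :=
  (M.measurePreserving_eval n).lintegral_comp hF

/-- Integrals against the exponential law, through its density. -/
lemma lintegral_exp (F : ℝ → ℝ≥0∞) (hF : Measurable F) :
    ∫⁻ w, F w ∂expMeasure M.lam
      = ∫⁻ w in Ici 0, ENNReal.ofReal (M.lam * Real.exp (-M.lam * w)) * F w := by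
  have hm : Measurable (exponentialPDF M.lam) := (measurable_exponentialPDFReal M.lam).ennreal_ofReal
  have : expMeasure M.lam = volume.withDensity (exponentialPDF M.lam) := rfl
  rw [this, lintegral_withDensity_eq_lintegral_mul _ hm hF,
    ← lintegral_indicator measurableSet_Ici]
  congr 1; ext w
  simp only [indicator, mem_Ici, Pi.mul_apply, exponentialPDF_eq]
  split_ifs <;> simp [neg_mul]

/-- The exponential law is memoryless. -/
lemma lintegral_exp_Ici {h : ℝ} (hh : 0 ≤ h) {F : ℝ → ℝ≥0∞} (hF : Measurable F) :
    ∫⁻ w in Ici h, F w ∂expMeasure M.lam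
      = ENNReal.ofReal (Real.exp (-M.lam * h)) * ∫⁻ w, F (h + w) ∂expMeasure M.lam := by
  rw [← lintegral_indicator measurableSet_Ici, lintegral_exp _ _ (hF.indicator measurableSet_Ici),
    lintegral_exp _ _ (by fun_prop), ← lintegral_const_mul _ (by fun_prop),
    ← lintegral_indicator measurableSet_Ici, ← lintegral_indicator measurableSet_Ici,
    ← lintegral_add_left_eq_self _ h]
  congr 1; ext w
  have : ENNReal.ofReal (M.lam * Real.exp (-M.lam * (h + w))) = ENNReal.ofReal (Real.exp (-M.lam * h))
      * ENNReal.ofReal (M.lam * Real.exp (-M.lam * w)) := by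
    rw [← ENNReal.ofReal_mul (Real.exp_pos _).le, mul_add, Real.exp_add]; ring_nf
  simp only [indicator, mem_Ici, this]
  by_cases hw : 0 ≤ w
  · simp [hw, add_nonneg hh hw, mul_assoc]
  · simp [hw]

lemma ae_exp_pos : ∀ᵐ w ∂expMeasure M.lam, 0 < w := by
  have : expMeasure M.lam = volume.withDensity (exponentialPDF M.lam) := rfl
  rw [ae_iff, this, withDensity_apply _ (by measurability)]
  have h0 : {a : ℝ | ¬ 0 < a} = Iic 0 := by ext; simp
  rw [h0, setLIntegral_congr (Iio_ae_eq_Iic).symm]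
  exact lintegral_exponentialPDF_of_nonpos le_rfl

lemma ae_G : ∀ᵐ z ∂M.G, z ∈ Ioo (0 : ℝ) 1 := by
  rw [ae_iff]; exact M.G_support

lemma ae_eventLaw : ∀ᵐ p ∂M.eventLaw, 0 < p.1 ∧ p.2 ∈ Ioo (0 : ℝ) 1 := by
  have h1 := (Measure.quasiMeasurePreserving_fst (μ := expMeasure M.lam) (ν := M.G)).ae M.ae_exp_pos
  have h2 := (Measure.quasiMeasurePreserving_snd (μ := expMeasure M.lam) (ν := M.G)).ae M.ae_G
  filter_upwards [h1, h2] with p h1 h2 using ⟨h1, h2⟩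

/-- The expected discount factor over a waiting time, `E exp (-δ τ)`. -/
def discount : ℝ := M.lam / (M.lam + M.delta)

lemma discount_pos : 0 < M.discount := div_pos M.lam_pos (add_pos M.lam_pos M.delta_pos)

lemma discount_lt_one : M.discount < 1 := by
  rw [discount, div_lt_one (add_pos M.lam_pos M.delta_pos)]; linarith [M.delta_pos]

lemma lintegral_exp_discount :
    ∫⁻ w, ENNReal.ofReal (Real.exp (-M.delta * w)) ∂expMeasure M.lam
      = ENNReal.ofReal M.discount := by
  have hR : 0 < M.lam + M.delta := add_pos M.lam_pos M.delta_pos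
  rw [lintegral_exp _ _ (by fun_prop), setLIntegral_congr Ioi_ae_eq_Ici.symm]
  have h1 : ∀ w : ℝ, ENNReal.ofReal (M.lam * Real.exp (-M.lam * w))
      * ENNReal.ofReal (Real.exp (-M.delta * w))
      = ENNReal.ofReal (M.lam * Real.exp (-(M.lam + M.delta) * w)) := fun w => by
    rw [← ENNReal.ofReal_mul (mul_nonneg M.lam_pos.le (Real.exp_pos _).le), mul_assoc,
      ← Real.exp_add]; ring_nf
  simp only [h1]
  rw [← ofReal_integral_eq_lintegral_ofReal]
  · rw [integral_const_mul, integral_exp_mul_Ioi (by linarith), discount]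
    simp [div_eq_mul_inv, neg_inv]
  · exact (integrableOn_exp_mul_Ioi (by linarith) 0).const_mul _
  · exact Eventually.of_forall fun w => mul_nonneg M.lam_pos.le (Real.exp_pos _).le

lemma lintegral_eventLaw_discount :
    ∫⁻ p, ENNReal.ofReal (Real.exp (-M.delta * p.1)) ∂M.eventLaw = ENNReal.ofReal M.discount := by
  rw [eventLaw, lintegral_prod _ (by fun_prop)]
  simp only [lintegral_const, measure_univ, mul_one, lintegral_exp_discount]

lemma lintegral_exp_discount_Ici {h : ℝ} (hh : 0 ≤ h) :
    ∫⁻ w in Ici h, ENNReal.ofReal (Real.exp (-M.delta * w)) ∂expMeasure M.lam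
      = ENNReal.ofReal (M.discount * Real.exp (-(M.lam + M.delta) * h)) := by
  rw [lintegral_exp_Ici _ hh (by fun_prop)]
  have : ∀ w, ENNReal.ofReal (Real.exp (-M.delta * (h + w))) = ENNReal.ofReal (Real.exp (-M.delta * h))
      * ENNReal.ofReal (Real.exp (-M.delta * w)) := fun w => by
    rw [← ENNReal.ofReal_mul (Real.exp_pos _).le, mul_add, Real.exp_add]
  simp only [this]
  rw [lintegral_const_mul _ (by fun_prop), lintegral_exp_discount, ← mul_assoc,
    ← ENNReal.ofReal_mul (Real.exp_pos _).le, ← ENNReal.ofReal_mul (by positivity), ← Real.exp_add]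
  ring_nf

lemma lintegral_exp_discount_Iio {h : ℝ} (hh : 0 ≤ h) :
    ∫⁻ w in Iio h, ENNReal.ofReal (Real.exp (-M.delta * w)) ∂expMeasure M.lam
      = ENNReal.ofReal (M.discount * (1 - Real.exp (-(M.lam + M.delta) * h))) := by
  have h1 := lintegral_add_compl (μ := expMeasure M.lam)
    (fun w => ENNReal.ofReal (Real.exp (-M.delta * w))) (measurableSet_Iio (a := h))
  rw [compl_Iio, lintegral_exp_discount, lintegral_exp_discount_Ici _ hh] at h1
  rw [ENNReal.eq_sub_of_add_eq ENNReal.ofReal_ne_top h1, ← ENNReal.ofReal_sub _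
    (mul_nonneg M.discount_pos.le (Real.exp_pos _).le)]
  ring_nf

/-- Scenarios with positive waiting times, proportions in `(0, 1)`, and arrival times tending to
infinity. -/
def regular : Set Scenario :=
  {ω | (∀ n, 0 < (ω n).1 ∧ (ω n).2 ∈ Ioo (0 : ℝ) 1) ∧ ∀ k : ℕ, ∃ n, (k : ℝ) < arrival n ω}

lemma measurable_arrival (n : ℕ) : Measurable (arrival n) := by
  unfold arrival; fun_prop

lemma arrival_succ (n : ℕ) (ω : Scenario) : arrival (n + 1) ω = arrival n ω + (ω n).1 := by
  simp [arrival, Finset.sum_range_succ]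

lemma arrival_zero (ω : Scenario) : arrival 0 ω = 0 := by simp [arrival]

lemma arrival_congr {n : ℕ} {ω ω' : Scenario} (h : ∀ i < n, ω i = ω' i) :
    arrival n ω = arrival n ω' :=
  Finset.sum_congr rfl fun i hi => by rw [h i (Finset.mem_range.1 hi)]

lemma arrival_splice {m n : ℕ} (h : m ≤ n) (ω ω' : Scenario) :
    arrival m (splice n ω ω') = arrival m ω :=
  arrival_congr fun _ hi => splice_of_lt (hi.trans_le h) _ _

lemma strictMono_arrival {ω : Scenario} (hω : ω ∈ regular) : StrictMono fun n => arrival n ω :=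
  strictMono_nat_of_lt_succ fun n => by rw [arrival_succ]; linarith [(hω.1 n).1]

lemma arrival_nonneg {ω : Scenario} (hω : ω ∈ regular) (n : ℕ) : 0 ≤ arrival n ω := by
  have := (strictMono_arrival hω).monotone (Nat.zero_le n)
  simpa [arrival_zero] using this

/-- The product of the discount factors over independent waiting times. -/
lemma lintegral_discount_arrival (n : ℕ) :
    ∫⁻ ω, ENNReal.ofReal (Real.exp (-M.delta * arrival n ω)) ∂M.prob
      = ENNReal.ofReal M.discount ^ n := by
  induction n with
  | zero => simp [arrival_zero]
  | succ n ih =>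
    have hm := measurable_arrival
    rw [M.lintegral_splice n (by fun_prop)]
    have : ∀ ω ω', ENNReal.ofReal (Real.exp (-M.delta * arrival (n + 1) (splice n ω ω')))
        = ENNReal.ofReal (Real.exp (-M.delta * arrival n ω))
          * ENNReal.ofReal (Real.exp (-M.delta * (ω' n).1)) := fun ω ω' => by
      rw [arrival_succ, arrival_splice le_rfl, splice_of_le le_rfl,
        ← ENNReal.ofReal_mul (Real.exp_pos _).le, mul_add, Real.exp_add]
    simp only [this]
    have h2 : ∀ ω, ∫⁻ ω', ENNReal.ofReal (Real.exp (-M.delta * arrival n ω))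
          * ENNReal.ofReal (Real.exp (-M.delta * (ω' n).1)) ∂M.prob
        = ENNReal.ofReal (Real.exp (-M.delta * arrival n ω)) * ENNReal.ofReal M.discount := fun ω => by
      rw [lintegral_const_mul _ (by fun_prop),
        M.lintegral_eval n (F := fun p => ENNReal.ofReal (Real.exp (-M.delta * p.1))) (by fun_prop),
        lintegral_eventLaw_discount]
    simp only [h2]
    rw [lintegral_mul_const _ (by fun_prop), ih, pow_succ]

lemma ae_regular : ∀ᵐ ω ∂M.prob, ω ∈ regular := by
  have h1 : ∀ᵐ ω ∂M.prob, ∀ n, 0 < (ω n).1 ∧ (ω n).2 ∈ Ioo (0 : ℝ) 1 :=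
    ae_all_iff.2 fun n => (M.measurePreserving_eval n).quasiMeasurePreserving.ae M.ae_eventLaw
  have hm := measurable_arrival
  have h2 : (fun ω => ⨅ n, ENNReal.ofReal (Real.exp (-M.delta * arrival n ω)))
      =ᵐ[M.prob] 0 := by
    refine (lintegral_eq_zero_iff (Measurable.iInf fun n => by fun_prop)).1 ?_
    refine le_antisymm ?_ zero_le
    refine ge_of_tendsto' (f := fun n => ENNReal.ofReal M.discount ^ n) (x := atTop)
      (ENNReal.tendsto_pow_atTop_nhds_zero_of_lt_one ?_) fun n => ?_
    · exact ENNReal.ofReal_lt_one.2 M.discount_lt_one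
    · rw [← M.lintegral_discount_arrival n]
      exact lintegral_mono fun ω => iInf_le _ n
  filter_upwards [h1, h2] with ω h1 h2
  simp only [Pi.zero_apply] at h2
  refine ⟨h1, fun k => ?_⟩
  by_contra! hk
  have : ENNReal.ofReal (Real.exp (-M.delta * k)) ≤ 0 := by
    rw [← h2]
    refine le_iInf fun n => ENNReal.ofReal_le_ofReal (Real.exp_le_exp.2 ?_)
    nlinarith [hk n, M.delta_pos]
  simp only [nonpos_iff_eq_zero, ENNReal.ofReal_eq_zero] at this
  exact absurd this (not_le.2 (Real.exp_pos _))

/-- On regular scenarios the number of events up to time `t` is characterized by the arrival times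
around `t`. -/
lemma count_eq {ω : Scenario} (hω : ω ∈ regular) {n : ℕ} {t : ℝ} (h1 : arrival n ω ≤ t)
    (h2 : t < arrival (n + 1) ω) : count t ω = n := by
  have hs := strictMono_arrival hω
  have : {k : ℕ | arrival (k + 1) ω ≤ t} = Iio n := by
    ext k
    simp only [mem_ofPred_eq, mem_Iio]
    constructor
    · intro hk
      have := hs.lt_iff_lt.1 (hk.trans_lt h2)
      omega
    · intro hk
      exact (hs.monotone (show k + 1 ≤ n from hk)).trans h1
  rw [count, this]
  simp [Set.ncard_eq_toFinset_card']

lemma exists_arrival {ω : Scenario} (hω : ω ∈ regular) {t : ℝ} (ht : 0 ≤ t) :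
    ∃ n, arrival n ω ≤ t ∧ t < arrival (n + 1) ω := by
  classical
  obtain ⟨k, hk⟩ := exists_nat_gt t
  obtain ⟨N, hN⟩ := hω.2 k
  have hex : ∃ n, t < arrival n ω := ⟨N, hk.trans hN⟩
  have h0 : Nat.find hex ≠ 0 := fun h => by
    have := Nat.find_spec hex
    rw [h, arrival_zero] at this; linarith
  obtain ⟨n, hn⟩ := Nat.exists_eq_succ_of_ne_zero h0
  refine ⟨n, not_lt.1 (Nat.find_min hex (by omega)), ?_⟩
  have := Nat.find_spec hex
  rwa [hn] at this

end CapitalModel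

/-! ### The Bellman operator of the first loss event -/

namespace CapitalModel

variable (M : CapitalModel)

/-- The expected discounted cost of following the control `m` up to the first loss event, starting
from the capital `y`, and of paying then the terminal cost `f`, a function of the capital right
after the loss. -/
def stepCost (f : ℝ → ℝ≥0∞) (y : ℝ) (m : Measure ℝ) : ℝ≥0∞ :=
  ∫⁻ p, (discMass M.delta m p.1
    + ENNReal.ofReal (Real.exp (-M.delta * p.1)) * f (p.2 * M.preLoss y m p.1)) ∂M.eventLaw

/-- The first-event Bellman operator. The constraint on `m` says that the transfer at time `0`
brings the capital to the poverty line at least; afterwards the capital cannot decrease before the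
next loss. -/
def bellman (f : ℝ → ℝ≥0∞) (y : ℝ) : ℝ≥0∞ :=
  ⨅ (m : Measure ℝ) (_ : IsControl m ∧ M.xstar ≤ y + (m {0}).toReal), M.stepCost f y m

variable {M}

lemma measurable_stepCost_integrand {f : ℝ → ℝ≥0∞} (hf : Measurable f) (y : ℝ) (m : Measure ℝ) :
    Measurable fun p : ℝ × ℝ => discMass M.delta m p.1
      + ENNReal.ofReal (Real.exp (-M.delta * p.1)) * f (p.2 * M.preLoss y m p.1) := by
  have h1 := measurable_discMass M.delta m
  have h2 := M.measurable_preLoss y m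
  fun_prop

lemma bellman_le (f : ℝ → ℝ≥0∞) {y : ℝ} {m : Measure ℝ} (hm : IsControl m)
    (h : M.xstar ≤ y + (m {0}).toReal) : M.bellman f y ≤ M.stepCost f y m :=
  iInf₂_le m ⟨hm, h⟩

lemma stepCost_mono {f g : ℝ → ℝ≥0∞} (h : ∀ y, f y ≤ g y) (y : ℝ) (m : Measure ℝ) :
    M.stepCost f y m ≤ M.stepCost g y m :=
  lintegral_mono fun p => by gcongr; exact h _

lemma bellman_mono {f g : ℝ → ℝ≥0∞} (h : ∀ y, f y ≤ g y) (y : ℝ) :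
    M.bellman f y ≤ M.bellman g y :=
  iInf₂_mono fun m _ => stepCost_mono h y m

lemma stepCost_anti {f : ℝ → ℝ≥0∞} (hf : Antitone f) {y y' : ℝ} (h : y ≤ y') (m : Measure ℝ) :
    M.stepCost f y' m ≤ M.stepCost f y m := by
  refine lintegral_mono_ae ?_
  filter_upwards [M.ae_eventLaw] with p hp
  gcongr
  exact hf (mul_le_mul_of_nonneg_left (M.preLoss_mono_left h m p.1) hp.2.1.le)

lemma bellman_antitone {f : ℝ → ℝ≥0∞} (hf : Antitone f) : Antitone (M.bellman f) :=
  fun _ _ h => le_iInf₂ fun m hm =>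
    (bellman_le f hm.1 (hm.2.trans (by linarith))).trans (stepCost_anti hf h m)

lemma mul_preLoss_nonneg {y : ℝ} {m : Measure ℝ} (hm : IsControl m)
    (h : M.xstar ≤ y + (m {0}).toReal) {p : ℝ × ℝ} (hp : 0 < p.1 ∧ p.2 ∈ Ioo (0 : ℝ) 1) :
    0 ≤ p.2 * M.preLoss y m p.1 :=
  mul_nonneg hp.2.1.le (M.xstar_pos.le.trans (M.xstar_le_preLoss hm h hp.1))

/-- The discount factor makes the Bellman operator a contraction. -/
lemma stepCost_le_add {f g : ℝ → ℝ≥0∞} {c : ℝ≥0∞} (hg : Measurable g)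
    (h : ∀ y, 0 ≤ y → f y ≤ g y + c) {y : ℝ} {m : Measure ℝ} (hm : IsControl m)
    (hy : M.xstar ≤ y + (m {0}).toReal) :
    M.stepCost f y m ≤ M.stepCost g y m + ENNReal.ofReal M.discount * c := by
  rw [← lintegral_eventLaw_discount, ← lintegral_mul_const _ (by fun_prop), stepCost, stepCost,
    ← lintegral_add_left (measurable_stepCost_integrand hg y m)]
  refine lintegral_mono_ae ?_
  filter_upwards [M.ae_eventLaw] with p hp
  rw [add_assoc, ← mul_add]
  gcongr
  exact h _ (mul_preLoss_nonneg hm hy hp)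

lemma bellman_le_add {f g : ℝ → ℝ≥0∞} {c : ℝ≥0∞} (hg : Measurable g)
    (h : ∀ y, 0 ≤ y → f y ≤ g y + c) (y : ℝ) :
    M.bellman f y ≤ M.bellman g y + ENNReal.ofReal M.discount * c := by
  conv_rhs => rw [bellman]
  simp_rw [ENNReal.iInf_add]
  exact le_iInf₂ fun m hm => (bellman_le f hm.1 hm.2).trans (stepCost_le_add hg h hm.1 hm.2)

/-- Transferring `c` at time `0` amounts to paying `c` and starting from the capital `y + c`. -/
lemma stepCost_add_dirac (f : ℝ → ℝ≥0∞) {y : ℝ} {m : Measure ℝ} (hm : IsControl m) {c : ℝ}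
    (hc : 0 ≤ c) : M.stepCost f y (m + ENNReal.ofReal c • Measure.dirac 0)
      = ENNReal.ofReal c + M.stepCost f (y + c) m := by
  have : ENNReal.ofReal c = ∫⁻ _, ENNReal.ofReal c ∂M.eventLaw := by simp
  conv_rhs => rw [this]
  rw [stepCost, stepCost, ← lintegral_add_left measurable_const]
  refine lintegral_congr_ae ?_
  filter_upwards [M.ae_eventLaw] with p hp
  rw [M.preLoss_add_dirac hm y hc hp.1, discMass_add_measure, discMass_dirac _ _ hp.1]
  ring

lemma toReal_add_dirac {m : Measure ℝ} (hm : IsControl m) {c : ℝ} (hc : 0 ≤ c) :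
    ((m + ENNReal.ofReal c • Measure.dirac 0 : Measure ℝ) {0}).toReal = (m {0}).toReal + c := by
  rw [Measure.add_apply, ENNReal.toReal_add hm.singleton_ne_top (by simp)]
  simp [hc]

lemma bellman_le_ofReal_add (f : ℝ → ℝ≥0∞) (y : ℝ) {c : ℝ} (hc : 0 ≤ c) :
    M.bellman f y ≤ ENNReal.ofReal c + M.bellman f (y + c) := by
  conv_rhs => rw [bellman]
  simp_rw [ENNReal.add_iInf]
  refine le_iInf₂ fun m hm => ?_
  rw [← stepCost_add_dirac f hm.1 hc]
  refine bellman_le f (hm.1.add (IsControl.dirac ENNReal.ofReal_ne_top)) ?_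
  rw [toReal_add_dirac hm.1 hc]
  linarith [hm.2]

/-- Below the poverty line the missing capital has to be transferred at once. -/
lemma ofReal_add_bellman_le (f : ℝ → ℝ≥0∞) {y : ℝ} (hy : y ≤ M.xstar) :
    ENNReal.ofReal (M.xstar - y) + M.bellman f M.xstar ≤ M.bellman f y := by
  refine le_iInf₂ fun m hm => ?_
  have hc : 0 ≤ M.xstar - y := by linarith
  have hle : ENNReal.ofReal (M.xstar - y) ≤ m {0} := by
    rw [← ENNReal.ofReal_toReal hm.1.singleton_ne_top]
    exact ENNReal.ofReal_le_ofReal (by linarith [hm.2])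
  have hm' : IsControl (m.restrict {0}ᶜ + (m {0} - ENNReal.ofReal (M.xstar - y)) • Measure.dirac 0) :=
    (hm.1.mono Measure.restrict_le_self).add
      (IsControl.dirac (ne_top_of_le_ne_top hm.1.singleton_ne_top tsub_le_self))
  have heq : m = (m.restrict {0}ᶜ + (m {0} - ENNReal.ofReal (M.xstar - y)) • Measure.dirac 0)
      + ENNReal.ofReal (M.xstar - y) • Measure.dirac 0 := by
    rw [add_assoc, ← add_smul, tsub_add_cancel_of_le hle, ← Measure.restrict_singleton, add_comm,
      Measure.restrict_add_restrict_compl (measurableSet_singleton _)]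
  conv_rhs => rw [heq]
  rw [stepCost_add_dirac f hm' hc]
  gcongr
  rw [show y + (M.xstar - y) = M.xstar by ring]
  exact bellman_le f hm' (by simp)

variable (M)

/-- The iterates of the Bellman operator, from the zero function: the least expected discounted
transfers up to the loss event number `k`. -/
def valueIter : ℕ → ℝ → ℝ≥0∞
  | 0 => fun _ => 0
  | k + 1 => M.bellman (valueIter k)

/-- The limit of the iterates of the Bellman operator; it turns out to be the value function. -/
def bellmanValue (y : ℝ) : ℝ≥0∞ := ⨆ k, M.valueIter k y

/-- A bound for the cost of bringing the capital back to the poverty line after each loss. -/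
def costBound : ℝ := M.xstar / (1 - M.discount)

lemma costBound_nonneg : 0 ≤ M.costBound :=
  div_nonneg M.xstar_pos.le (by linarith [M.discount_lt_one])

lemma valueIter_antitone (k : ℕ) : Antitone (M.valueIter k) := by
  induction k with
  | zero => exact fun _ _ _ => le_rfl
  | succ k ih => exact bellman_antitone ih

lemma bellmanValue_antitone : Antitone M.bellmanValue := fun _ _ h =>
  iSup_mono fun k => M.valueIter_antitone k h

lemma valueIter_le_costBound (k : ℕ) {y : ℝ} (hy : 0 ≤ y) :
    M.valueIter k y ≤ ENNReal.ofReal M.costBound := by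
  induction k generalizing y with
  | zero => simp [valueIter]
  | succ k ih =>
    have hx := M.xstar_pos.le
    have h1 : IsControl (0 + ENNReal.ofReal M.xstar • Measure.dirac 0 : Measure ℝ) :=
      IsControl.zero.add (IsControl.dirac ENNReal.ofReal_ne_top)
    have h2 : M.xstar ≤ y + ((0 + ENNReal.ofReal M.xstar • Measure.dirac 0 : Measure ℝ) {0}).toReal := by
      rw [toReal_add_dirac IsControl.zero hx]; simp [hy]
    refine (bellman_le _ h1 h2).trans ((stepCost_le_add (g := fun _ => 0) measurable_const
      (c := ENNReal.ofReal M.costBound) (fun y hy => by simpa using ih hy) h1 h2).trans ?_)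
    rw [stepCost_add_dirac _ IsControl.zero hx]
    have h3 : M.stepCost (fun _ => 0) (y + M.xstar) 0 = 0 := by simp [stepCost, discMass]
    rw [h3, add_zero, ← ENNReal.ofReal_mul M.discount_pos.le, ← ENNReal.ofReal_add hx
      (mul_nonneg M.discount_pos.le M.costBound_nonneg)]
    refine ENNReal.ofReal_le_ofReal (le_of_eq ?_)
    have : 1 - M.discount ≠ 0 := by linarith [M.discount_lt_one]
    rw [costBound]; field_simp; ring

lemma bellmanValue_le_costBound {y : ℝ} (hy : 0 ≤ y) :
    M.bellmanValue y ≤ ENNReal.ofReal M.costBound :=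
  iSup_le fun k => M.valueIter_le_costBound k hy

lemma bellmanValue_ne_top {y : ℝ} (hy : 0 ≤ y) : M.bellmanValue y ≠ ∞ :=
  ne_top_of_le_ne_top ENNReal.ofReal_ne_top (M.bellmanValue_le_costBound hy)

lemma valueIter_le_add (j k : ℕ) {y : ℝ} (hy : 0 ≤ y) : M.valueIter j y
    ≤ M.valueIter k y + ENNReal.ofReal M.discount ^ k * ENNReal.ofReal M.costBound := by
  induction k generalizing j y with
  | zero => simpa [valueIter] using M.valueIter_le_costBound j hy
  | succ k ih =>
    cases j with
    | zero => simp [valueIter]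
    | succ j =>
      rw [pow_succ', mul_assoc]
      exact bellman_le_add (M.valueIter_antitone k).measurable (fun y hy => ih j hy) y

/-- The limit of the value iteration solves the Bellman equation. -/
lemma bellman_bellmanValue (y : ℝ) : M.bellman M.bellmanValue y = M.bellmanValue y := by
  refine le_antisymm ?_ (iSup_le fun k => ?_)
  · have h1 : ∀ k, M.bellman M.bellmanValue y ≤ M.bellmanValue y
        + ENNReal.ofReal M.discount ^ (k + 1) * ENNReal.ofReal M.costBound := fun k => by
      rw [pow_succ', mul_assoc]
      refine (bellman_le_add (M.valueIter_antitone k).measurable (c := ENNReal.ofReal M.discount ^ k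
        * ENNReal.ofReal M.costBound) (fun y hy => iSup_le fun j => M.valueIter_le_add j k hy)
        y).trans ?_
      gcongr
      exact le_iSup (fun k => M.valueIter k y) (k + 1)
    have h2 : Tendsto (fun k => M.bellmanValue y
        + ENNReal.ofReal M.discount ^ (k + 1) * ENNReal.ofReal M.costBound) atTop
        (𝓝 (M.bellmanValue y + 0 * ENNReal.ofReal M.costBound)) := by
      refine tendsto_const_nhds.add (ENNReal.Tendsto.mul_const ?_ (Or.inr ENNReal.ofReal_ne_top))
      exact (ENNReal.tendsto_pow_atTop_nhds_zero_of_lt_one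
        (ENNReal.ofReal_lt_one.2 M.discount_lt_one)).comp (tendsto_add_atTop_nat 1)
    simpa using ge_of_tendsto' h2 h1
  · cases k with
    | zero => simp [valueIter]
    | succ k => exact bellman_mono (fun y => le_iSup (fun k => M.valueIter k y) k) y

lemma bellmanValue_le_ofReal_add (y : ℝ) {c : ℝ} (hc : 0 ≤ c) :
    M.bellmanValue y ≤ ENNReal.ofReal c + M.bellmanValue (y + c) := by
  refine iSup_le fun k => ?_
  cases k with
  | zero => simp [valueIter]
  | succ k =>
    refine (bellman_le_ofReal_add _ y hc).trans ?_
    gcongr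
    exact le_iSup (fun k => M.valueIter k (y + c)) (k + 1)

lemma bellmanValue_of_le {y : ℝ} (hy : y ≤ M.xstar) :
    M.bellmanValue y = ENNReal.ofReal (M.xstar - y) + M.bellmanValue M.xstar := by
  refine le_antisymm ?_ ?_
  · simpa using M.bellmanValue_le_ofReal_add y (c := M.xstar - y) (by linarith)
  · rw [← M.bellman_bellmanValue y, ← M.bellman_bellmanValue M.xstar]
    exact ofReal_add_bellman_le _ hy

end CapitalModel

/-! ### Dynamic programming at a deterministic time -/

namespace CapitalModel

variable (M : CapitalModel)

/-- The dynamic programming identity at a deterministic time `h`, which rests on the lack of memory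
of the exponential law. -/
lemma stepCost_split {f : ℝ → ℝ≥0∞} (hf : Measurable f) (y : ℝ) {m : Measure ℝ} (hm : IsControl m)
    {h : ℝ} (hh : 0 ≤ h) :
    M.stepCost f y m = (∫⁻ w in Iio h, ∫⁻ z, (discMass M.delta m w
        + ENNReal.ofReal (Real.exp (-M.delta * w)) * f (z * M.preLoss y m w)) ∂M.G ∂expMeasure M.lam)
      + (ENNReal.ofReal (Real.exp (-M.lam * h)) * discMass M.delta m h
        + ENNReal.ofReal (Real.exp (-(M.lam + M.delta) * h))
          * M.stepCost f (M.preLoss y m h) (shiftMeasure h m)) := by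
  have hF := measurable_stepCost_integrand (M := M) hf y m
  have hF' := measurable_stepCost_integrand (M := M) hf (M.preLoss y m h) (shiftMeasure h m)
  have hI := hF.lintegral_prod_right' (ν := M.G)
  have hI' := hF'.lintegral_prod_right' (ν := M.G)
  rw [stepCost, stepCost, eventLaw, lintegral_prod _ hF.aemeasurable,
    lintegral_prod _ hF'.aemeasurable, ← lintegral_add_compl _ (measurableSet_Iio (a := h)),
    compl_Iio]
  congr 1
  have hexp : Real.exp (-(M.lam + M.delta) * h)
      = Real.exp (-M.lam * h) * Real.exp (-M.delta * h) := by rw [← Real.exp_add]; ring_nf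
  rw [M.lintegral_exp_Ici hh hI, hexp, ENNReal.ofReal_mul (Real.exp_pos _).le, mul_assoc, ← mul_add]
  congr 1
  rw [← lintegral_const_mul _ hI']
  have : discMass M.delta m h = ∫⁻ _, discMass M.delta m h ∂expMeasure M.lam := by simp
  rw [this, ← lintegral_add_left measurable_const]
  refine lintegral_congr_ae ?_
  filter_upwards [M.ae_exp_pos] with w hw
  have hs : Measurable fun z => f (z * M.preLoss (M.preLoss y m h) (shiftMeasure h m) w) := by
    fun_prop
  simp only [M.preLoss_add hm y hh hw.le, discMass_add_apply _ _ hh hw.le]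
  rw [lintegral_add_left measurable_const, lintegral_add_left measurable_const,
    lintegral_add_left measurable_const, lintegral_const_mul _ hs, lintegral_const_mul _ hs]
  simp only [lintegral_const, measure_univ, mul_one]
  rw [mul_add (-M.delta), Real.exp_add, ENNReal.ofReal_mul (Real.exp_pos _).le]
  ring

/-- The expected value right after a loss that hits the capital `y`. -/
def afterLoss (y : ℝ) : ℝ≥0∞ := ∫⁻ z, M.bellmanValue (z * y) ∂M.G

lemma afterLoss_ne_top {y : ℝ} (hy : 0 ≤ y) : M.afterLoss y ≠ ∞ := by
  refine ne_top_of_le_ne_top (b := ENNReal.ofReal M.costBound) ENNReal.ofReal_ne_top ?_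
  calc M.afterLoss y ≤ ∫⁻ _, ENNReal.ofReal M.costBound ∂M.G := by
        refine lintegral_mono_ae ?_
        filter_upwards [M.ae_G] with z hz
        exact M.bellmanValue_le_costBound (mul_nonneg hz.1.le hy)
    _ = _ := by simp

lemma afterLoss_le_ofReal_add (y : ℝ) {c : ℝ} (hc : 0 ≤ c) :
    M.afterLoss y ≤ ENNReal.ofReal c + M.afterLoss (y + c) := by
  have h : ENNReal.ofReal c = ∫⁻ _, ENNReal.ofReal c ∂M.G := by simp
  rw [h, afterLoss, afterLoss, ← lintegral_add_left measurable_const]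
  refine lintegral_mono_ae ?_
  filter_upwards [M.ae_G] with z hz
  refine (M.bellmanValue_le_ofReal_add (z * y) (mul_nonneg hz.1.le hc)).trans ?_
  rw [← mul_add]
  gcongr
  nlinarith [hz.2]

/-- Making no transfer up to time `h` gives an upper bound for the value function. -/
lemma bellmanValue_le_of_wait {x h : ℝ} (hx : M.xstar ≤ x) (hh : 0 ≤ h) :
    M.bellmanValue x ≤ M.afterLoss x
        * ENNReal.ofReal (M.discount * (1 - Real.exp (-(M.lam + M.delta) * h)))
      + ENNReal.ofReal (Real.exp (-(M.lam + M.delta) * h))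
        * M.bellmanValue (M.xstar + Real.exp (M.r * h) * (x - M.xstar)) := by
  set xh := M.xstar + Real.exp (M.r * h) * (x - M.xstar) with hxh
  rw [← M.bellman_bellmanValue xh, bellman]
  simp_rw [ENNReal.mul_iInf_of_ne (ENNReal.ofReal_pos.2 (Real.exp_pos _)).ne' ENNReal.ofReal_ne_top,
    ENNReal.add_iInf]
  refine le_iInf₂ fun m hm => ?_
  have hd := hm.1.delay hh
  rw [← M.bellman_bellmanValue x]
  refine (bellman_le _ hd (hx.trans (by simp))).trans ?_
  have hpre : ∀ w ≤ h, M.preLoss x (delayMeasure h m) w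
      = M.xstar + Real.exp (M.r * w) * (x - M.xstar) := fun w hw => by
    rw [preLoss, discMass_delayMeasure hm.1 _ hw]; simp
  have hmeas := M.bellmanValue_antitone.measurable
  rw [M.stepCost_split hmeas x hd hh, discMass_delayMeasure hm.1 _ le_rfl,
    shiftMeasure_delayMeasure hm.1, hpre h le_rfl, mul_zero, zero_add, ← hxh]
  gcongr
  rw [← M.lintegral_exp_discount_Iio hh, ← lintegral_const_mul _ (by fun_prop)]
  refine setLIntegral_mono_ae (by fun_prop) ?_
  filter_upwards [M.ae_exp_pos] with w hw hwh
  rw [hpre w hwh.le, discMass_delayMeasure hm.1 _ hwh.le]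
  simp only [zero_add]
  rw [lintegral_const_mul _ (by fun_prop), mul_comm]
  gcongr
  refine lintegral_mono_ae ?_
  filter_upwards [M.ae_G] with z hz
  refine M.bellmanValue_antitone (mul_le_mul_of_nonneg_left ?_ hz.1.le)
  have : 1 ≤ Real.exp (M.r * w) := Real.one_le_exp (mul_nonneg M.r_pos.le hw.le)
  nlinarith

/-- A lower bound for the cost of a control in terms of the capital `a` that its transfers before
time `h` have added at time `h`. -/
lemma le_stepCost {x h : ℝ} (hx : M.xstar ≤ x) (hh : 0 ≤ h) {m : Measure ℝ} (hm : IsControl m) :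
    ∃ a, 0 ≤ a ∧ ENNReal.ofReal (Real.exp (-(M.lam + M.delta + M.r) * h) * a)
      + M.afterLoss (M.xstar + Real.exp (M.r * h) * (x - M.xstar) + a)
        * ENNReal.ofReal (M.discount * (1 - Real.exp (-(M.lam + M.delta) * h)))
      + ENNReal.ofReal (Real.exp (-(M.lam + M.delta) * h))
        * M.bellmanValue (M.xstar + Real.exp (M.r * h) * (x - M.xstar) + a)
      ≤ M.stepCost M.bellmanValue x m := by
  have hmeas := M.bellmanValue_antitone.measurable
  have hD := hm.discMass_ne_top M.r_pos.le h
  have hpre : M.preLoss x m h = M.xstar + Real.exp (M.r * h) * (x - M.xstar)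
      + Real.exp (M.r * h) * (discMass M.r m h).toReal := by rw [preLoss]; ring
  refine ⟨Real.exp (M.r * h) * (discMass M.r m h).toReal, by positivity, ?_⟩
  rw [← hpre, M.stepCost_split hmeas x hm hh, add_comm (ENNReal.ofReal _), add_assoc]
  refine add_le_add ?_ (add_le_add ?_ ?_)
  · rw [← M.lintegral_exp_discount_Iio hh, ← lintegral_const_mul _ (by fun_prop)]
    refine setLIntegral_mono_ae' measurableSet_Iio ?_
    filter_upwards [M.ae_exp_pos] with w hw hwh
    rw [lintegral_add_left measurable_const, lintegral_const_mul _ (by fun_prop), mul_comm]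
    refine le_add_left ?_
    gcongr
    refine lintegral_mono_ae ?_
    filter_upwards [M.ae_G] with z hz
    exact M.bellmanValue_antitone (mul_le_mul_of_nonneg_left
      (M.preLoss_mono_right hm hx (le_of_lt hwh)) hz.1.le)
  · refine le_trans (le_of_eq ?_) (mul_le_mul_right (exp_mul_discMass_le M.delta_pos.le M.r_pos.le m h)
      (ENNReal.ofReal (Real.exp (-M.lam * h))))
    rw [← mul_assoc, ENNReal.ofReal_mul (by positivity), ENNReal.ofReal_mul (Real.exp_pos _).le,
      ENNReal.ofReal_toReal hD, ← mul_assoc, ← ENNReal.ofReal_mul (Real.exp_pos _).le,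
      ← ENNReal.ofReal_mul (Real.exp_pos _).le, ← Real.exp_add, ← Real.exp_add]
    ring_nf
  · gcongr
    conv_lhs => rw [← M.bellman_bellmanValue]
    refine bellman_le _ (hm.shift h) ?_
    have : M.xstar ≤ M.preLoss x m h := by
      rw [hpre]
      have := mul_nonneg (Real.exp_pos (M.r * h)).le (sub_nonneg.2 hx)
      have := mul_nonneg (Real.exp_pos (M.r * h)).le (ENNReal.toReal_nonneg (a := discMass M.r m h))
      linarith
    exact this.trans (by simp)

end CapitalModel

/-! ### The viscosity property -/

lemma HasDerivAt.nonneg_of_right_nonneg {k : ℝ → ℝ} {d : ℝ} (hk : HasDerivAt k d 0) (h0 : k 0 = 0)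
    (h : ∀ c, 0 ≤ c → 0 ≤ k c) : 0 ≤ d := by
  have h1 := (hasDerivAt_iff_tendsto_slope.1 hk).mono_left
    (nhdsWithin_mono 0 (s := Ioi 0) fun x (hx : 0 < x) => hx.ne')
  refine ge_of_tendsto h1 ?_
  filter_upwards [self_mem_nhdsWithin] with c (hc : 0 < c)
  rw [slope_def_field, h0]
  have := h c hc.le
  simp only [sub_zero]
  positivity

lemma HasDerivAt.eventually_lt_right {k : ℝ → ℝ} {d p : ℝ} (hk : HasDerivAt k d 0) (hp : p < d) :
    ∀ᶠ c in 𝓝[>] (0 : ℝ), k 0 + p * c < k c := by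
  have h1 := (hasDerivAt_iff_tendsto_slope.1 hk).mono_left
    (nhdsWithin_mono 0 (s := Ioi 0) fun x (hx : 0 < x) => hx.ne')
  filter_upwards [self_mem_nhdsWithin, h1.eventually (lt_mem_nhds hp)] with c (hc : 0 < c) h2
  rw [slope_def_field, sub_zero, lt_div_iff₀ hc] at h2
  linarith

namespace CapitalModel

variable (M : CapitalModel)

/-- The real-valued solution of the Bellman equation. -/
def realValue (y : ℝ) : ℝ := (M.bellmanValue y).toReal

lemma realValue_nonneg (y : ℝ) : 0 ≤ M.realValue y := ENNReal.toReal_nonneg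

lemma realValue_anti {y y' : ℝ} (hy : 0 ≤ y) (h : y ≤ y') : M.realValue y' ≤ M.realValue y :=
  ENNReal.toReal_mono (M.bellmanValue_ne_top hy) (M.bellmanValue_antitone h)

lemma realValue_le_add {y c : ℝ} (hy : 0 ≤ y) (hc : 0 ≤ c) :
    M.realValue y ≤ c + M.realValue (y + c) := by
  have := ENNReal.toReal_mono (ENNReal.add_ne_top.2 ⟨ENNReal.ofReal_ne_top,
    M.bellmanValue_ne_top (add_nonneg hy hc)⟩) (M.bellmanValue_le_ofReal_add y hc)
  rwa [ENNReal.toReal_add ENNReal.ofReal_ne_top (M.bellmanValue_ne_top (add_nonneg hy hc)),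
    ENNReal.toReal_ofReal hc] at this

lemma realValue_of_le {y : ℝ} (hy : y ≤ M.xstar) :
    M.realValue y = M.realValue M.xstar + M.xstar - y := by
  rw [realValue, M.bellmanValue_of_le hy, ENNReal.toReal_add ENNReal.ofReal_ne_top
    (M.bellmanValue_ne_top M.xstar_pos.le), ENNReal.toReal_ofReal (by linarith), realValue]
  ring

lemma lipschitzOnWith_realValue : LipschitzOnWith 1 M.realValue (Ici 0) := by
  refine LipschitzOnWith.of_le_add fun x (hx : 0 ≤ x) y (hy : 0 ≤ y) => ?_
  rw [Real.dist_eq]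
  rcases le_total x y with h | h
  · have := M.realValue_le_add hx (sub_nonneg.2 h)
    rw [add_sub_cancel] at this
    have := neg_le_abs (x - y)
    linarith
  · have := M.realValue_anti hy h
    have := abs_nonneg (x - y)
    linarith

lemma continuousOn_realValue : ContinuousOn M.realValue (Ici 0) :=
  M.lipschitzOnWith_realValue.continuousOn

/-- The expected value right after a loss that hits the capital `y`, as a real number. -/
def realAfterLoss (y : ℝ) : ℝ := (M.afterLoss y).toReal

lemma realAfterLoss_nonneg (y : ℝ) : 0 ≤ M.realAfterLoss y := ENNReal.toReal_nonneg

lemma realAfterLoss_le_add {y c : ℝ} (hy : 0 ≤ y) (hc : 0 ≤ c) :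
    M.realAfterLoss y ≤ c + M.realAfterLoss (y + c) := by
  have := ENNReal.toReal_mono (ENNReal.add_ne_top.2 ⟨ENNReal.ofReal_ne_top,
    M.afterLoss_ne_top (add_nonneg hy hc)⟩) (M.afterLoss_le_ofReal_add y hc)
  rwa [ENNReal.toReal_add ENNReal.ofReal_ne_top (M.afterLoss_ne_top (add_nonneg hy hc)),
    ENNReal.toReal_ofReal hc] at this

/-- The part of the generator that comes from the losses, divided by the intensity. -/
def lossTerm (f : ℝ → ℝ) (x : ℝ) : ℝ :=
  ∫ z in Ioc 0 (M.xstar / x), (f M.xstar + M.xstar - x * z) ∂M.G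
    + ∫ z in Ioc (M.xstar / x) 1, f (x * z) ∂M.G

lemma generator_eq (f : ℝ → ℝ) (x : ℝ) : M.generator f x
    = M.r * (x - M.xstar) * deriv f x - (M.lam + M.delta) * f x + M.lam * M.lossTerm f x := by
  rw [generator, lossTerm]; ring

lemma integrableOn_affine (a b c d : ℝ) : IntegrableOn (fun z => a - b * z) (Ioc c d) M.G :=
  ((by fun_prop : Continuous fun z : ℝ => a - b * z).continuousOn.integrableOn_compact
    isCompact_Icc).mono_set Ioc_subset_Icc_self

lemma integrableOn_comp_mul {f : ℝ → ℝ} (hf : ContinuousOn f (Ici M.xstar)) {x : ℝ}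
    (hx : M.xstar < x) : IntegrableOn (fun z => f (x * z)) (Ioc (M.xstar / x) 1) M.G := by
  refine (ContinuousOn.integrableOn_compact isCompact_Icc ?_).mono_set Ioc_subset_Icc_self
  refine hf.comp (by fun_prop) fun z hz => ?_
  have := (div_le_iff₀ (M.xstar_pos.trans hx)).1 hz.1
  rw [mem_Ici]; linarith

lemma lossTerm_mono {f g : ℝ → ℝ} (hf : ContinuousOn f (Ici M.xstar))
    (hg : ContinuousOn g (Ici M.xstar)) (h : ∀ y, M.xstar ≤ y → f y ≤ g y) {x : ℝ}
    (hx : M.xstar < x) : M.lossTerm f x ≤ M.lossTerm g x := by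
  refine add_le_add ?_ ?_
  · refine setIntegral_mono_on (M.integrableOn_affine _ _ _ _) (M.integrableOn_affine _ _ _ _)
      measurableSet_Ioc fun z _ => ?_
    linarith [h M.xstar le_rfl]
  · refine setIntegral_mono_on (M.integrableOn_comp_mul hf hx) (M.integrableOn_comp_mul hg hx)
      measurableSet_Ioc fun z hz => h _ ?_
    have := (div_lt_iff₀ (M.xstar_pos.trans hx)).1 hz.1
    linarith

lemma lossTerm_realValue {x : ℝ} (hx : M.xstar < x) :
    M.lossTerm M.realValue x = M.realAfterLoss x := by
  have hx0 := M.xstar_pos.trans hx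
  have hc0 : 0 < M.xstar / x := div_pos M.xstar_pos hx0
  have hc1 : M.xstar / x ≤ 1 := ((div_lt_one hx0).2 hx).le
  have hm := M.bellmanValue_antitone.measurable
  have hall : ∫ z, M.realValue (x * z) ∂M.G = M.realAfterLoss x := by
    rw [realAfterLoss, afterLoss, ← integral_toReal (by fun_prop)]
    · simp only [realValue, mul_comm]
    · filter_upwards [M.ae_G] with z hz
      exact (M.bellmanValue_ne_top (mul_nonneg hz.1.le hx0.le)).lt_top
  have heq : EqOn (fun z => M.realValue M.xstar + M.xstar - x * z) (fun z => M.realValue (x * z))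
      (Ioc 0 (M.xstar / x)) := fun z hz => by
    have := (le_div_iff₀ hx0).1 hz.2
    exact (M.realValue_of_le (by linarith)).symm
  rw [← hall, lossTerm, setIntegral_congr_fun measurableSet_Ioc heq,
    ← setIntegral_union (by
      rw [Set.disjoint_left]; intro z; simp only [mem_Ioc]; grind) measurableSet_Ioc
      ((M.integrableOn_affine _ _ _ _).congr_fun heq measurableSet_Ioc)
      (M.integrableOn_comp_mul (M.continuousOn_realValue.mono (Ici_subset_Ici.2 M.xstar_pos.le)) hx),
    Ioc_union_Ioc_eq_Ioc hc0.le hc1, Measure.restrict_eq_self_of_ae_mem]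
  filter_upwards [M.ae_G] with z hz using ⟨hz.1, hz.2.le⟩

lemma realValue_le_of_wait {x h : ℝ} (hx : M.xstar ≤ x) (hh : 0 ≤ h) :
    M.realValue x ≤ M.realAfterLoss x * (M.discount * (1 - Real.exp (-(M.lam + M.delta) * h)))
      + Real.exp (-(M.lam + M.delta) * h)
        * M.realValue (M.xstar + Real.exp (M.r * h) * (x - M.xstar)) := by
  have hx0 := M.xstar_pos.le.trans hx
  have hy0 : 0 ≤ M.xstar + Real.exp (M.r * h) * (x - M.xstar) :=
    add_nonneg M.xstar_pos.le (mul_nonneg (Real.exp_pos _).le (sub_nonneg.2 hx))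
  have hd : 0 ≤ M.discount * (1 - Real.exp (-(M.lam + M.delta) * h)) := by
    refine mul_nonneg M.discount_pos.le (sub_nonneg.2 (Real.exp_le_one_iff.2 ?_))
    nlinarith [M.lam_pos, M.delta_pos]
  have h1 : M.afterLoss x
        * ENNReal.ofReal (M.discount * (1 - Real.exp (-(M.lam + M.delta) * h))) ≠ ∞ :=
    ENNReal.mul_ne_top (M.afterLoss_ne_top hx0) ENNReal.ofReal_ne_top
  have h2 := ENNReal.mul_ne_top (ENNReal.ofReal_ne_top (r := Real.exp (-(M.lam + M.delta) * h)))
    (M.bellmanValue_ne_top hy0)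
  have := ENNReal.toReal_mono (ENNReal.add_ne_top.2 ⟨h1, h2⟩) (M.bellmanValue_le_of_wait hx hh)
  rwa [ENNReal.toReal_add h1 h2, ENNReal.toReal_mul, ENNReal.toReal_mul, ENNReal.toReal_ofReal hd,
    ENNReal.toReal_ofReal (Real.exp_pos _).le] at this

lemma exists_le_realValue_add {x h ε : ℝ} (hx : M.xstar ≤ x) (hh : 0 ≤ h) (hε : 0 < ε) :
    ∃ a, 0 ≤ a ∧ Real.exp (-(M.lam + M.delta + M.r) * h) * a
      + M.realAfterLoss (M.xstar + Real.exp (M.r * h) * (x - M.xstar) + a)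
        * (M.discount * (1 - Real.exp (-(M.lam + M.delta) * h)))
      + Real.exp (-(M.lam + M.delta) * h)
        * M.realValue (M.xstar + Real.exp (M.r * h) * (x - M.xstar) + a) ≤ M.realValue x + ε := by
  have hx0 := M.xstar_pos.le.trans hx
  have hd : 0 ≤ M.discount * (1 - Real.exp (-(M.lam + M.delta) * h)) := by
    refine mul_nonneg M.discount_pos.le (sub_nonneg.2 (Real.exp_le_one_iff.2 ?_))
    nlinarith [M.lam_pos, M.delta_pos]
  have hlt : M.bellman M.bellmanValue x < M.bellmanValue x + ENNReal.ofReal ε := by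
    rw [M.bellman_bellmanValue]
    exact ENNReal.lt_add_right (M.bellmanValue_ne_top hx0) (by simpa using hε)
  simp only [bellman, iInf_lt_iff] at hlt
  obtain ⟨m, hm, hlt⟩ := hlt
  obtain ⟨a, ha, hle⟩ := M.le_stepCost hx hh hm.1
  refine ⟨a, ha, ?_⟩
  have hy0 : 0 ≤ M.xstar + Real.exp (M.r * h) * (x - M.xstar) + a :=
    add_nonneg (add_nonneg M.xstar_pos.le (mul_nonneg (Real.exp_pos _).le (sub_nonneg.2 hx))) ha
  have h1 := ENNReal.mul_ne_top (M.afterLoss_ne_top hy0)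
    (ENNReal.ofReal_ne_top (r := M.discount * (1 - Real.exp (-(M.lam + M.delta) * h))))
  have h2 := ENNReal.mul_ne_top (ENNReal.ofReal_ne_top (r := Real.exp (-(M.lam + M.delta) * h)))
    (M.bellmanValue_ne_top hy0)
  have := ENNReal.toReal_mono (ENNReal.add_ne_top.2 ⟨M.bellmanValue_ne_top hx0,
    ENNReal.ofReal_ne_top⟩) (hle.trans hlt.le)
  rwa [ENNReal.toReal_add (ENNReal.add_ne_top.2 ⟨ENNReal.ofReal_ne_top, h1⟩) h2,
    ENNReal.toReal_add ENNReal.ofReal_ne_top h1, ENNReal.toReal_mul, ENNReal.toReal_mul,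
    ENNReal.toReal_ofReal hd, ENNReal.toReal_ofReal (Real.exp_pos _).le,
    ENNReal.toReal_ofReal (mul_nonneg (Real.exp_pos _).le ha),
    ENNReal.toReal_add (M.bellmanValue_ne_top hx0) ENNReal.ofReal_ne_top,
    ENNReal.toReal_ofReal hε.le] at this

lemma IsTestFunction.hasDerivAt {M : CapitalModel} {f : ℝ → ℝ} (hf : M.IsTestFunction f) {x : ℝ}
    (hx : M.xstar < x) : HasDerivAt f (deriv f x) x :=
  ((hf.2.contDiffAt (Ioi_mem_nhds hx)).differentiableAt (by simp)).hasDerivAt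

lemma hasDerivAt_exp_mul_zero (k : ℝ) : HasDerivAt (fun h : ℝ => Real.exp (k * h)) k 0 := by
  have h1 : HasDerivAt (fun h : ℝ => k * h) k 0 := by simpa using (hasDerivAt_id (0 : ℝ)).const_mul k
  simpa using h1.exp

lemma discount_mul : M.discount * (M.lam + M.delta) = M.lam :=
  div_mul_cancel₀ _ (add_pos M.lam_pos M.delta_pos).ne'

lemma realValue_supersolution {x : ℝ} (hx : M.xstar < x) {φ : ℝ → ℝ} (hφ : M.IsTestFunction φ)
    (heq : φ x = M.realValue x) (hle : ∀ y, M.xstar ≤ y → M.realValue y ≤ φ y) :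
    0 ≤ min (1 + deriv φ x) (M.generator φ x) := by
  have hx0 := M.xstar_pos.trans hx
  have hd := hφ.hasDerivAt hx
  refine le_min ?_ ?_
  · have h1 : HasDerivAt (fun c => c + φ (x + c) - φ x) (1 + deriv φ x) 0 := by
      refine ((hasDerivAt_id (0 : ℝ)).add ?_).sub_const _
      exact HasDerivAt.comp_const_add x 0 (by simpa using hd)
    refine h1.nonneg_of_right_nonneg (by simp) fun c hc => ?_
    have := M.realValue_le_add hx0.le hc
    have := hle (x + c) (by linarith)
    linarith
  · have hX : HasDerivAt (fun h => M.xstar + Real.exp (M.r * h) * (x - M.xstar))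
        (M.r * (x - M.xstar)) 0 :=
      ((hasDerivAt_exp_mul_zero M.r).mul_const _).const_add _
    have hφX : HasDerivAt (fun h => φ (M.xstar + Real.exp (M.r * h) * (x - M.xstar)))
        (deriv φ x * (M.r * (x - M.xstar))) 0 := by
      refine HasDerivAt.comp (0 : ℝ) (h₂ := φ) ?_ hX
      simpa using hd
    have hE := hasDerivAt_exp_mul_zero (-(M.lam + M.delta))
    have h1 := (((((hE.const_sub 1).const_mul M.discount).const_mul (M.realAfterLoss x)).add
      (hE.mul hφX))).sub_const (φ x)
    have h2 := h1.nonneg_of_right_nonneg (by simp) fun h hh => by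
      have h3 := M.realValue_le_of_wait hx.le hh
      have h4 : M.realValue (M.xstar + Real.exp (M.r * h) * (x - M.xstar))
          ≤ φ (M.xstar + Real.exp (M.r * h) * (x - M.xstar)) :=
        hle _ (by have := mul_pos (Real.exp_pos (M.r * h)) (sub_pos.2 hx); linarith)
      have h5 := mul_le_mul_of_nonneg_left h4 (Real.exp_pos (-(M.lam + M.delta) * h)).le
      simp only [Pi.add_apply, Pi.mul_apply]
      linarith
    have h6 := M.lossTerm_mono (M.continuousOn_realValue.mono (Ici_subset_Ici.2 M.xstar_pos.le))
      hφ.1 hle hx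
    rw [M.lossTerm_realValue hx] at h6
    rw [generator_eq]
    have h7 := mul_le_mul_of_nonneg_left h6 M.lam_pos.le
    simp only [mul_zero, Real.exp_zero, one_mul, add_sub_cancel, neg_neg, M.discount_mul] at h2
    linarith

lemma realValue_subsolution {x : ℝ} (hx : M.xstar < x) {ψ : ℝ → ℝ} (hψ : M.IsTestFunction ψ)
    (heq : ψ x = M.realValue x) (hle : ∀ y, M.xstar ≤ y → ψ y ≤ M.realValue y) :
    min (1 + deriv ψ x) (M.generator ψ x) ≤ 0 := by
  by_contra! hpos
  obtain ⟨hp1, hgen⟩ := lt_min_iff.1 hpos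
  have hx0 := M.xstar_pos.trans hx
  have hd := hψ.hasDerivAt hx
  have hloss := M.lossTerm_mono hψ.1
    (M.continuousOn_realValue.mono (Ici_subset_Ici.2 M.xstar_pos.le)) hle hx
  rw [M.lossTerm_realValue hx] at hloss
  rw [generator_eq, heq] at hgen
  have hloss' := mul_le_mul_of_nonneg_left hloss M.lam_pos.le
  set u := M.realValue x with hu
  set g := M.realAfterLoss x with hg
  set R := M.lam + M.delta with hR
  have hRpos : 0 < R := add_pos M.lam_pos M.delta_pos
  have hu0 : 0 ≤ u := M.realValue_nonneg x
  have hrx : 0 < M.r * (x - M.xstar) := mul_pos M.r_pos (sub_pos.2 hx)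
  -- a slope `-q` slightly below the slope of `ψ` still makes both terms positive
  obtain ⟨q, hq1, hqd, hqA⟩ : ∃ q, q < 1 ∧ -q < deriv ψ x ∧
      0 < M.lam * g - R * u - q * (M.r * (x - M.xstar)) := by
    have hA : 0 < M.lam * g - R * u + deriv ψ x * (M.r * (x - M.xstar)) := by linarith
    obtain ⟨ε, hε, h1, h2⟩ : ∃ ε > 0, ε < 1 + deriv ψ x ∧
        ε * (M.r * (x - M.xstar)) < M.lam * g - R * u + deriv ψ x * (M.r * (x - M.xstar)) := by
      have hm := lt_min hp1 (div_pos hA hrx)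
      obtain ⟨ε, hε, hε'⟩ := exists_between hm
      exact ⟨ε, hε, (lt_min_iff.1 hε').1, (lt_div_iff₀ hrx).1 (lt_min_iff.1 hε').2⟩
    exact ⟨ε - deriv ψ x, by linarith, by linarith, by linarith⟩
  obtain ⟨η, hη, hnear⟩ : ∃ η > 0, ∀ b, 0 ≤ b → b ≤ η → u - q * b ≤ M.realValue (x + b) := by
    have h1 : HasDerivAt (fun b => ψ (x + b)) (deriv ψ x) 0 :=
      HasDerivAt.comp_const_add x 0 (by simpa using hd)
    obtain ⟨η, hη, h2⟩ := mem_nhdsGT_iff_exists_Ioc_subset.1 (h1.eventually_lt_right hqd)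
    refine ⟨η, hη, fun b hb hbη => ?_⟩
    rcases hb.eq_or_lt with rfl | hb
    · simp [hu]
    · have h3 : ψ (x + 0) + -q * b < ψ (x + b) := h2 ⟨hb, hbη⟩
      rw [add_zero, heq] at h3
      have := hle (x + b) (by linarith)
      linarith
  have hfar : ∀ b, η ≤ b → u + (1 - q) * η - b ≤ M.realValue (x + b) := fun b hb => by
    have h1 := M.realValue_le_add (y := x + η) (c := b - η) (by linarith) (by linarith)
    rw [show x + η + (b - η) = x + b by ring] at h1
    have h2 := hnear η hη.le le_rfl
    linarith
  -- all the estimates below hold for a small enough time step `h`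
  have hcont : ∀ {k : ℝ → ℝ}, Continuous k → Tendsto k (𝓝[>] 0) (𝓝 (k 0)) := fun hk =>
    hk.continuousAt.continuousWithinAt
  have e1 : ∀ᶠ h in 𝓝[>] (0 : ℝ), 0 < Real.exp (-(R + M.r) * h)
      - M.discount * (1 - Real.exp (-R * h)) - q * Real.exp (-R * h) :=
    (hcont (by fun_prop)).eventually (lt_mem_nhds (by simp; linarith))
  have e2 : ∀ᶠ h in 𝓝[>] (0 : ℝ), u < (g - (Real.exp (M.r * h) - 1) * (x - M.xstar))
      * (M.discount * (1 - Real.exp (-R * h)))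
      + Real.exp (-R * h) * (u - q * ((Real.exp (M.r * h) - 1) * (x - M.xstar))) := by
    have hE := hasDerivAt_exp_mul_zero (-R)
    have hB := ((hasDerivAt_exp_mul_zero M.r).sub_const 1).mul_const (x - M.xstar)
    have h1 := ((hB.const_sub g).mul ((hE.const_sub 1).const_mul M.discount)).add
      (hE.mul ((hB.const_mul q).const_sub u))
    have h2 := h1.eventually_lt_right (p := 0) (by
      simp only [mul_zero, Real.exp_zero, sub_self, zero_mul, sub_zero, one_mul, neg_neg]
      rw [M.discount_mul]; linarith)
    filter_upwards [h2] with h h3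
    simpa using h3
  have e3 : ∀ᶠ h in 𝓝[>] (0 : ℝ), 1 / 2 < Real.exp (-(R + M.r) * h) :=
    (hcont (by fun_prop)).eventually (lt_mem_nhds (by norm_num))
  have e4 : ∀ᶠ h in 𝓝[>] (0 : ℝ), u + (1 - q) * η / 2 < Real.exp (-R * h) * (u + (1 - q) * η
      - (Real.exp (M.r * h) - 1) * (x - M.xstar))
      - (Real.exp (-R * h) - Real.exp (-(R + M.r) * h)) * (2 * u + 4) :=
    (hcont (by fun_prop)).eventually (lt_mem_nhds (by
      have := mul_pos (sub_pos.2 hq1) hη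
      simp; linarith))
  obtain ⟨h, h1, h2, h3, h4, hh⟩ := (e1.and (e2.and (e3.and (e4.and self_mem_nhdsWithin)))).exists
  replace hh : 0 < h := hh
  set bh := (Real.exp (M.r * h) - 1) * (x - M.xstar) with hbh
  have hbh0 : 0 ≤ bh := mul_nonneg (sub_nonneg.2 (Real.one_le_exp
    (mul_nonneg M.r_pos.le hh.le))) (sub_nonneg.2 hx.le)
  obtain ⟨ε, hε, hε'⟩ := exists_between (lt_min (sub_pos.2 h2) (lt_min one_pos
    (half_pos (mul_pos (sub_pos.2 hq1) hη))))
  simp only [lt_min_iff] at hε'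
  obtain ⟨hε1, hε2, hε3⟩ := hε'
  obtain ⟨a, ha, hB⟩ := M.exists_le_realValue_add hx.le hh.le hε
  rw [show M.xstar + Real.exp (M.r * h) * (x - M.xstar) + a = x + (bh + a) by rw [hbh]; ring,
    ← hR] at hB
  have hER : Real.exp (-R * h) ≤ 1 := Real.exp_le_one_iff.2 (by nlinarith)
  have hE0 := Real.exp_pos (-R * h)
  have hD0 : 0 ≤ M.discount * (1 - Real.exp (-R * h)) :=
    mul_nonneg M.discount_pos.le (sub_nonneg.2 hER)
  have hg0 := mul_nonneg (M.realAfterLoss_nonneg (x + (bh + a))) hD0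
  have hEr : Real.exp (-(R + M.r) * h) ≤ Real.exp (-R * h) :=
    Real.exp_le_exp.2 (by nlinarith [mul_pos M.r_pos hh])
  -- transfers that add `2 u + 4` or more already cost too much
  rcases le_total (2 * u + 4) a with hbig | hsmall
  · have h5 := mul_nonneg hE0.le (M.realValue_nonneg (x + (bh + a)))
    have h6 := mul_le_mul_of_nonneg_right h3.le ha
    linarith
  -- otherwise the capital at time `h` is compared with `x + η`, the limit of the range of `hnear`
  rcases le_total (bh + a) η with hb | hb
  · have h5 := mul_le_mul_of_nonneg_left (hnear (bh + a) (by linarith) hb) hE0.le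
    have h6 := mul_le_mul_of_nonneg_right
      (sub_le_iff_le_add'.2 (M.realAfterLoss_le_add hx0.le (by linarith : 0 ≤ bh + a))) hD0
    have h7 := mul_nonneg h1.le ha
    linarith
  · have h5 := mul_le_mul_of_nonneg_left (hfar (bh + a) hb) hE0.le
    have h6 := mul_le_mul_of_nonneg_left hsmall (sub_nonneg.2 hEr)
    linarith

end CapitalModel

/-! ### Stieltjes paths, measurability, and the capital at the loss events -/

lemma Iio_eq_iUnion_Iic (T : ℝ) : Iio T = ⋃ q : {q : ℚ // (q : ℝ) < T}, Iic (q : ℝ) := by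
  ext a
  simp only [mem_Iio, mem_iUnion, mem_Iic, Subtype.exists, exists_prop]
  exact ⟨fun h => let ⟨q, h1, h2⟩ := exists_rat_btwn h; ⟨q, h2, h1.le⟩,
    fun ⟨q, h1, h2⟩ => h2.trans_lt h1⟩

namespace StieltjesFunction

variable {F F' : StieltjesFunction ℝ}

lemma measure_Iic_of_zero (h0 : ∀ t < 0, F t = 0) (t : ℝ) :
    F.measure (Iic t) = ENNReal.ofReal (F t) := by
  have : Tendsto F atBot (𝓝 0) := tendsto_const_nhds.congr' (by
    filter_upwards [eventually_lt_atBot 0] with t ht using (h0 t ht).symm)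
  rw [F.measure_Iic this, sub_zero]

lemma isControl (h0 : ∀ t < 0, F t = 0) : IsControl F.measure := by
  refine ⟨?_, fun t => by rw [measure_Iic_of_zero h0]; exact ENNReal.ofReal_ne_top⟩
  rw [Iio_eq_iUnion_Iic, measure_iUnion_null_iff]
  intro q
  rw [measure_Iic_of_zero h0, h0 _ q.2, ENNReal.ofReal_zero]

end StieltjesFunction

/-- A control is determined on `(-∞, T)` by its cumulative transfers before `T`. -/
lemma IsControl.restrict_Iio_congr {m m' : Measure ℝ} (hm : IsControl m) {T : ℝ}
    (h : ∀ t < T, m (Iic t) = m' (Iic t)) : m.restrict (Iio T) = m'.restrict (Iio T) := by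
  rw [Iio_eq_iUnion_Iic, Measure.restrict_iUnion_congr]
  intro q
  have hf : IsFiniteMeasure (m.restrict (Iic (q : ℝ))) :=
    ⟨by rw [Measure.restrict_apply_univ]; exact (hm.fin _).lt_top⟩
  refine Measure.ext_of_Iic _ _ fun t => ?_
  rw [Measure.restrict_apply measurableSet_Iic, Measure.restrict_apply measurableSet_Iic,
    Iic_inter_Iic]
  exact h _ (inf_le_right.trans_lt q.2)

lemma restrict_shiftMeasure_congr {m m' : Measure ℝ} {h T : ℝ}
    (hmm : m.restrict (Iio (h + T)) = m'.restrict (Iio (h + T))) :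
    (shiftMeasure h m).restrict (Iio T) = (shiftMeasure h m').restrict (Iio T) := by
  have : ∀ μ : Measure ℝ, (shiftMeasure h μ).restrict (Iio T)
      = ((μ.restrict (Iio (h + T))).restrict (Ici h)).map fun a => a - h := fun μ => by
    rw [shiftMeasure, Measure.restrict_map (by fun_prop) measurableSet_Iio,
      Measure.restrict_restrict (measurableSet_Iio.preimage (by fun_prop)),
      Measure.restrict_restrict measurableSet_Ici]
    congr 2
    ext a
    simp only [mem_inter_iff, mem_preimage, mem_Iio, mem_Ici]
    constructor <;> rintro ⟨h1, h2⟩ <;> constructor <;> linarith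
  rw [this, this, hmm]

lemma restrict_Iio_mono {m m' : Measure ℝ} {s t : ℝ} (h : s ≤ t)
    (hmm : m.restrict (Iio t) = m'.restrict (Iio t)) :
    m.restrict (Iio s) = m'.restrict (Iio s) := by
  have : ∀ μ : Measure ℝ, μ.restrict (Iio s) = (μ.restrict (Iio t)).restrict (Iio s) := fun μ => by
    rw [Measure.restrict_restrict measurableSet_Iio, inter_eq_left.2 (Iio_subset_Iio h)]
  rw [this m, this m', hmm]

section Measurability

variable {Ω : Type*} [MeasurableSpace Ω] {κ : Ω → Measure ℝ}

lemma measurable_discMass_left (hκ : ∀ t, Measurable fun ω => κ ω (Iic t))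
    (hc : ∀ ω, IsControl (κ ω)) (k w : ℝ) : Measurable fun ω => discMass k (κ ω) w := by
  have hf : ∀ ω, IsFiniteMeasure ((κ ω).restrict (Iic w)) := fun ω =>
    ⟨by rw [Measure.restrict_apply_univ]; exact ((hc ω).fin _).lt_top⟩
  have h1 : Measurable fun ω => (κ ω).restrict (Iic w) := by
    refine Measurable.measure_of_isPiSystem (borel_eq_generateFrom_Iic ℝ ▸ BorelSpace.measurable_eq)
      isPiSystem_Iic ?_ ?_
    · rintro _ ⟨t, rfl⟩
      simp only [Measure.restrict_apply measurableSet_Iic, Iic_inter_Iic]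
      exact hκ _
    · simp only [Measure.restrict_apply_univ]
      exact hκ _
  have h2 : ∀ ω, discMass k (κ ω) w
      = ∫⁻ a, (Ico 0 w).indicator (fun a => ENNReal.ofReal (Real.exp (-k * a))) a
        ∂((κ ω).restrict (Iic w)) := fun ω => by
    rw [lintegral_indicator measurableSet_Ico, Measure.restrict_restrict measurableSet_Ico,
      inter_eq_left.2 fun a ha => ha.2.le]
    rfl
  simp only [h2]
  exact (Measure.measurable_lintegral ((measurable_ofReal_exp k).indicator measurableSet_Ico)).comp h1

/-- The discounted mass is left continuous in time, hence determined by the rational times; this makes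
it measurable at random times. -/
lemma discMass_eq_iSup (k : ℝ) (m : Measure ℝ) (w : ℝ) :
    discMass k m w = ⨆ q : ℚ, if (q : ℝ) ≤ w then discMass k m q else 0 := by
  refine le_antisymm ?_ (iSup_le fun q => ?_)
  · have h : Ico 0 w = ⋃ q : {q : ℚ // (q : ℝ) ≤ w}, Ico 0 (q : ℝ) := by
      ext a
      simp only [mem_Ico, mem_iUnion, Subtype.exists, exists_prop]
      constructor
      · rintro ⟨h0, h1⟩
        obtain ⟨q, h2, h3⟩ := exists_rat_btwn h1
        exact ⟨q, h3.le, h0, h2⟩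
      · rintro ⟨q, h2, h0, h1⟩
        exact ⟨h0, h1.trans_le h2⟩
    rw [discMass, h, setLIntegral_iUnion_of_directed _ (directed_of_isDirected_le
      fun q q' hq => Ico_subset_Ico_right (by exact_mod_cast hq))]
    refine iSup_le fun q => le_iSup_of_le q.1 ?_
    rw [if_pos q.2]; rfl
  · split_ifs with h
    · exact discMass_mono k m h
    · exact zero_le

lemma measurable_discMass_comp (hκ : ∀ t, Measurable fun ω => κ ω (Iic t))
    (hc : ∀ ω, IsControl (κ ω)) (k : ℝ) {w : Ω → ℝ} (hw : Measurable w) :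
    Measurable fun ω => discMass k (κ ω) (w ω) := by
  simp_rw [discMass_eq_iSup k _ (w _)]
  refine Measurable.iSup fun q => Measurable.ite (measurableSet_le measurable_const hw)
    (measurable_discMass_left hκ hc k q) measurable_const

end Measurability

namespace CapitalModel

variable (M : CapitalModel)

/-- The capital right after the loss event number `n` and before the transfer at that time, when
the transfers are given by the measure `κ`. -/
def preCapital (x : ℝ) (κ : Measure ℝ) (ω : Scenario) : ℕ → ℝ
  | 0 => x
  | n + 1 => (ω n).2 * M.preLoss (preCapital x κ ω n) (shiftMeasure (arrival n ω) κ) (ω n).1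

lemma preCapital_congr (x : ℝ) {κ κ' : Measure ℝ} {ω ω' : Scenario} (hω : ω ∈ regular) {n : ℕ}
    (h : ∀ i < n, ω i = ω' i)
    (hκ : κ.restrict (Iio (arrival n ω)) = κ'.restrict (Iio (arrival n ω))) :
    M.preCapital x κ ω n = M.preCapital x κ' ω' n := by
  induction n with
  | zero => rfl
  | succ n ih =>
    have hle : arrival n ω ≤ arrival (n + 1) ω := ((strictMono_arrival hω) (Nat.lt_succ_self n)).le
    rw [preCapital, preCapital, ← ih (fun i hi => h i (by omega)) (restrict_Iio_mono hle hκ),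
      ← h n (Nat.lt_succ_self n), ← arrival_congr (fun i hi => h i (by omega) : ∀ i < n, ω i = ω' i)]
    rw [arrival_succ] at hκ
    rw [M.preLoss_congr _ (restrict_shiftMeasure_congr hκ) le_rfl]

lemma discMass_arrival_succ {ω : Scenario} (hω : ω ∈ regular) (k : ℝ) (κ : Measure ℝ) (n : ℕ) :
    discMass k κ (arrival (n + 1) ω) = discMass k κ (arrival n ω)
      + ENNReal.ofReal (Real.exp (-k * arrival n ω))
        * discMass k (shiftMeasure (arrival n ω) κ) (ω n).1 := by
  rw [arrival_succ, discMass_add_apply _ _ (arrival_nonneg hω n) (hω.1 n).1.le]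

lemma measurable_preCapital {κ : Scenario → Measure ℝ}
    (hκ : ∀ t, Measurable fun ω => κ ω (Iic t)) (hc : ∀ ω, IsControl (κ ω))
    (h0 : ∀ ω, ω ∉ regular → κ ω = 0) (x : ℝ) (n : ℕ) :
    Measurable fun ω => M.preCapital x (κ ω) ω n := by
  induction n with
  | zero => exact measurable_const
  | succ n ih =>
    have h1 : Measurable fun ω => discMass M.r (shiftMeasure (arrival n ω) (κ ω)) (ω n).1 := by
      have h2 : ∀ ω, discMass M.r (shiftMeasure (arrival n ω) (κ ω)) (ω n).1
          = ENNReal.ofReal (Real.exp (M.r * arrival n ω))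
            * (discMass M.r (κ ω) (arrival (n + 1) ω) - discMass M.r (κ ω) (arrival n ω)) := by
        intro ω
        by_cases hω : ω ∈ regular
        · rw [discMass_arrival_succ hω, ENNReal.add_sub_cancel_left
            ((hc ω).discMass_ne_top M.r_pos.le _), ← mul_assoc,
            ← ENNReal.ofReal_mul (Real.exp_pos _).le, ← Real.exp_add]
          simp
        · simp [h0 ω hω, discMass, shiftMeasure]
      simp only [h2]
      have h3 := measurable_discMass_comp hκ hc M.r (measurable_arrival n)
      have h4 := measurable_discMass_comp hκ hc M.r (measurable_arrival (n + 1))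
      have h5 := measurable_arrival n
      fun_prop
    simp only [preCapital, preLoss]
    fun_prop

/-- The capital right after an event is the capital before the transfer plus the atom of the
transfers at that time. -/
lemma capitalAtArrival_eq {S : StieltjesFunction ℝ} (h0 : ∀ t < 0, S t = 0) (x : ℝ) {ω : Scenario}
    (hω : ω ∈ regular) (n : ℕ) : M.capitalAtArrival x S ω n
      = M.preCapital x S.measure ω n + (S.measure {arrival n ω}).toReal := by
  have hatom : ∀ t, (S.measure {t}).toReal = S t - Function.leftLim S t := fun t => by
    rw [S.measure_singleton, ENNReal.toReal_ofReal (sub_nonneg.2 (S.mono.leftLim_le le_rfl))]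
  induction n with
  | zero =>
    have hm := (StieltjesFunction.isControl h0)
    have : S.measure {0} = S.measure (Iic 0) := by
      rw [← Iio_union_right, measure_union (by simp) (measurableSet_singleton _), hm.neg, zero_add]
    rw [capitalAtArrival, preCapital, arrival_zero, this, StieltjesFunction.measure_Iic_of_zero h0,
      ENNReal.toReal_ofReal]
    exact (h0 (-1) (by norm_num)).symm.le.trans (S.mono (by norm_num))
  | succ n ih =>
    rw [capitalAtArrival, preCapital, hatom, ih]
    congr 1
    rw [mul_comm, proportion]
    congr 1
    set s := arrival n ω
    set y := M.preCapital x S.measure ω n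
    have hs : s < arrival (n + 1) ω := strictMono_arrival hω (Nat.lt_succ_self n)
    have hw : arrival (n + 1) ω = s + (ω n).1 := arrival_succ n ω
    set t := arrival (n + 1) ω
    have hm := (StieltjesFunction.isControl h0).shift s
    have h1 : discMass M.r (shiftMeasure s S.measure) (ω n).1
        = ∫⁻ a in Ico s t, ENNReal.ofReal (Real.exp (-M.r * (a - s))) ∂S.measure := by
      rw [discMass_shiftMeasure, hw]
    have h2 : ∫⁻ a in Ico s t, ENNReal.ofReal (Real.exp (-M.r * (a - s))) ∂S.measure
        = S.measure {s} + ∫⁻ a in Ioo s t, ENNReal.ofReal (Real.exp (-M.r * (a - s))) ∂S.measure := by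
      rw [← Ioo_union_left hs, lintegral_union (measurableSet_singleton _) (by simp), add_comm,
        lintegral_singleton]
      simp
    have hfin := hm.discMass_ne_top M.r_pos.le (ω n).1
    rw [h1, h2, ENNReal.add_ne_top] at hfin
    have h3 : ∫ a in Ioo s t, Real.exp (M.r * (t - a)) ∂S.measure
        = Real.exp (M.r * (ω n).1)
          * (∫⁻ a in Ioo s t, ENNReal.ofReal (Real.exp (-M.r * (a - s))) ∂S.measure).toReal := by
      rw [← integral_eq_lintegral_of_nonneg_ae (Eventually.of_forall fun a => (Real.exp_pos _).le)
        (by fun_prop), ← integral_const_mul]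
      congr 1; ext a
      rw [← Real.exp_add, hw]; ring_nf
    rw [flow, preLoss, h3, h1, h2, ENNReal.toReal_add hfin.1 hfin.2,
      show t - s = (ω n).1 by linarith]
    ring

/-- The poverty line constraint only has to be checked at the event times. -/
lemma forall_xstar_le_capital_iff (S : StieltjesFunction ℝ) (x : ℝ) {ω : Scenario}
    (hω : ω ∈ regular) : (∀ t, 0 ≤ t → M.xstar ≤ M.capital x S ω t)
      ↔ ∀ n, M.xstar ≤ M.capitalAtArrival x S ω n := by
  constructor
  · intro h n
    have := h _ (arrival_nonneg hω n)
    rw [capital, count_eq hω le_rfl (strictMono_arrival hω (Nat.lt_succ_self n))] at this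
    simpa [flow] using this
  · intro h t ht
    obtain ⟨n, h1, h2⟩ := exists_arrival hω ht
    rw [capital, count_eq hω h1 h2, flow]
    have h3 : 0 ≤ ∫ a in Ioc (arrival n ω) t, Real.exp (M.r * (t - a)) ∂S.measure :=
      integral_nonneg fun a => (Real.exp_pos _).le
    have := mul_nonneg (sub_nonneg.2 (h n)) (Real.exp_pos (M.r * (t - arrival n ω))).le
    linarith

end CapitalModel

/-! ### Admissible strategies as families of deterministic controls -/

lemma StieltjesFunction.exists_rat_lt (F : StieltjesFunction ℝ) {t v T : ℝ} (hv : F t < v)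
    (hT : t < T) : ∃ q : ℚ, t < q ∧ (q : ℝ) < T ∧ F q < v := by
  have h1 : ∀ᶠ s in 𝓝[>] t, F s < v :=
    ((F.right_continuous t).mono Ioi_subset_Ici_self).eventually (gt_mem_nhds hv)
  obtain ⟨u, hu, h2⟩ := mem_nhdsGT_iff_exists_Ioo_subset.1 h1
  obtain ⟨q, h3, h4⟩ := exists_rat_btwn (lt_min hT hu)
  exact ⟨q, h3, h4.trans_le (min_le_left _ _), h2 ⟨h3, h4.trans_le (min_le_right _ _)⟩⟩

namespace CapitalModel

variable {M : CapitalModel}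

lemma measurable_proportion (n : ℕ) : Measurable (proportion n) := by
  unfold proportion; fun_prop

lemma rawHistory_le (t : ℝ) : rawHistory t ≤ (inferInstance : MeasurableSpace Scenario) := by
  refine MeasurableSpace.generateFrom_le ?_
  rintro _ ⟨n, A, hA, rfl⟩
  exact (measurableSet_le (measurable_arrival _) measurable_const).inter
    (hA.preimage ((measurable_arrival _).prodMk (measurable_proportion n)))

/-- Two scenarios with the same first `n` events cannot be told apart before either of the next
events. -/
lemma mem_iff_of_rawHistory {t : ℝ} {B : Set Scenario} (hB : MeasurableSet[rawHistory t] B)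
    {ω ω' : Scenario} (hω : ω ∈ regular) (hω' : ω' ∈ regular) {n : ℕ} (h : ∀ i < n, ω i = ω' i)
    (ht : t < arrival (n + 1) ω) (ht' : t < arrival (n + 1) ω') : ω ∈ B ↔ ω' ∈ B := by
  refine MeasurableSpace.generateFrom_induction _ (fun B _ => (ω ∈ B ↔ ω' ∈ B)) ?_ (by simp)
    (fun B _ hB => not_congr hB) (fun B _ hB => ?_) B hB
  · rintro _ ⟨k, A, hA, rfl⟩ -
    simp only [mem_ofPred_eq]
    by_cases hk : k < n
    · rw [arrival_congr (fun i hi => h i (by omega) : ∀ i < k + 1, ω i = ω' i), proportion,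
        proportion, h k hk]
    · have h1 := (strictMono_arrival hω).monotone (show n + 1 ≤ k + 1 by omega)
      have h2 := (strictMono_arrival hω').monotone (show n + 1 ≤ k + 1 by omega)
      constructor <;> rintro ⟨h3, -⟩ <;> linarith
  · simp only [mem_iUnion]
    exact exists_congr hB

/-- Off a null set an admissible strategy is Borel measurable, keeps the capital above the poverty
line, and depends up to the next event only on the past events. -/
lemma IsAdmissible.exists_regularization {x : ℝ} {S : Scenario → StieltjesFunction ℝ}
    (hS : M.IsAdmissible x S) : ∃ Ω : Set Scenario, MeasurableSet Ω ∧ (∀ᵐ ω ∂M.prob, ω ∈ Ω) ∧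
      Ω ⊆ regular ∧ (∀ ω ∈ Ω, ∀ n, M.xstar ≤ M.capitalAtArrival x (S ω) ω n) ∧
      (∀ ω ∈ Ω, ∀ ω' ∈ Ω, ∀ n, (∀ i < n, ω i = ω' i) → ∀ t, t < arrival (n + 1) ω →
        t < arrival (n + 1) ω' → S ω t = S ω' t) ∧
      ∀ t, Measurable fun ω => Ω.indicator (fun ω => S ω t) ω := by
  classical
  have hB : ∀ q v : ℚ, ∃ B, MeasurableSet[rawHistory q] B ∧
      ∀ᵐ ω ∂M.prob, (S ω q < v ↔ ω ∈ B) := fun q v => by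
    rcases lt_or_ge (q : ℝ) 0 with hq | hq
    · by_cases hv : (0 : ℝ) < v
      · exact ⟨univ, @MeasurableSet.univ _ (rawHistory q), Eventually.of_forall fun ω => by
          rw [hS.zero_of_neg ω q hq]; simpa using hv⟩
      · exact ⟨∅, @MeasurableSet.empty _ (rawHistory q), Eventually.of_forall fun ω => by
          rw [hS.zero_of_neg ω q hq]; simpa using hv⟩
    · obtain ⟨B, hB, hSB⟩ := hS.adapted q hq (measurableSet_Iio (a := (v : ℝ)))
      exact ⟨B, hB, hSB.mem_iff⟩
  choose B hB hBS using hB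
  have hae : ∀ᵐ ω ∂M.prob, ω ∈ regular ∧ (∀ n, M.xstar ≤ M.capitalAtArrival x (S ω) ω n) ∧
      ∀ q v : ℚ, (S ω q < v ↔ ω ∈ B q v) := by
    filter_upwards [M.ae_regular, hS.above, ae_all_iff.2 fun q => ae_all_iff.2 fun v => hBS q v]
      with ω h1 h2 h3
    exact ⟨h1, (M.forall_xstar_le_capital_iff _ _ h1).1 h2, h3⟩
  obtain ⟨N, hN, hNm, hN0⟩ := exists_measurable_superset_of_null (ae_iff.1 hae)
  have hΩ : ∀ ω ∈ Nᶜ, ω ∈ regular ∧ (∀ n, M.xstar ≤ M.capitalAtArrival x (S ω) ω n) ∧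
      ∀ q v : ℚ, (S ω q < v ↔ ω ∈ B q v) := fun ω hω => by
    by_contra h
    exact hω (hN h)
  refine ⟨Nᶜ, hNm.compl, compl_mem_ae_iff.2 hN0, fun ω hω => (hΩ ω hω).1,
    fun ω hω => (hΩ ω hω).2.1, ?_, fun t => ?_⟩
  · have hle : ∀ ω ∈ Nᶜ, ∀ ω' ∈ Nᶜ, ∀ n, (∀ i < n, ω i = ω' i) → ∀ t, t < arrival (n + 1) ω →
        t < arrival (n + 1) ω' → S ω t ≤ S ω' t := fun ω hω ω' hω' n hn t ht ht' => by
      by_contra! hlt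
      obtain ⟨v, hv1, hv2⟩ := exists_rat_btwn hlt
      obtain ⟨q, hq1, hq2, hq3⟩ := (S ω').exists_rat_lt hv1 (lt_min ht ht')
      rw [lt_min_iff] at hq2
      have := ((hΩ ω hω).2.2 q v).2 ((mem_iff_of_rawHistory (hB q v) (hΩ ω hω).1 (hΩ ω' hω').1 hn
        hq2.1 hq2.2).2 (((hΩ ω' hω').2.2 q v).1 hq3))
      linarith [(S ω).mono hq1.le]
    exact fun ω hω ω' hω' n hn t ht ht' => le_antisymm (hle ω hω ω' hω' n hn t ht ht')
      (hle ω' hω' ω hω n (fun i hi => (hn i hi).symm) t ht' ht)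
  · refine measurable_of_Iio fun v => ?_
    have heq : (fun ω => Nᶜ.indicator (fun ω => S ω t) ω) ⁻¹' Iio v
        = (Nᶜ ∩ ⋃ q : ℚ, ⋃ p : ℚ, if t < q ∧ (p : ℝ) ≤ v then B q p else ∅)
          ∪ (if 0 < v then N else ∅) := by
      ext ω
      by_cases hω : ω ∈ N
      · by_cases hv : 0 < v <;> simp [hω, hv]
      · have hiff : S ω t < v ↔ ∃ q p : ℚ, (t < q ∧ (p : ℝ) ≤ v) ∧ ω ∈ B q p := by
          constructor
          · intro h
            obtain ⟨p, hp1, hp2⟩ := exists_rat_btwn h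
            obtain ⟨q, hq1, -, hq3⟩ := (S ω).exists_rat_lt hp1 (lt_add_one t)
            exact ⟨q, p, ⟨hq1, hp2.le⟩, ((hΩ ω hω).2.2 q p).1 hq3⟩
          · rintro ⟨q, p, ⟨hq, hp⟩, h⟩
            exact ((S ω).mono hq.le).trans_lt ((((hΩ ω hω).2.2 q p).2 h).trans_le hp)
        have hN' : ω ∉ (if 0 < v then N else ∅) := by split_ifs <;> simp [hω]
        have hi : Nᶜ.indicator (fun ω => S ω t) ω = S ω t := indicator_of_mem hω _
        simp only [mem_preimage, mem_Iio, hi, hiff, mem_union, hN', or_false, mem_inter_iff,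
          mem_compl_iff, hω, not_false_eq_true, true_and, mem_iUnion]
        refine exists_congr fun q => exists_congr fun p => ?_
        split_ifs with h <;> simp [h]
    rw [heq]
    refine (hNm.compl.inter (MeasurableSet.iUnion fun q => MeasurableSet.iUnion fun p => ?_)).union ?_
    · split_ifs
      · exact rawHistory_le _ _ (hB q p)
      · exact MeasurableSet.empty
    · split_ifs
      · exact hNm
      · exact MeasurableSet.empty

/-- A family of controls indexed by the scenarios, which can react to the first event only after
its time, costs at least the minimum over the deterministic controls. -/
lemma bellman_le_lintegral {f : ℝ → ℝ≥0∞} {b : ℝ≥0∞} (hf : Measurable f) (hb : b ≠ ∞)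
    (hfb : ∀ y, 0 ≤ y → f y ≤ b) {y : ℝ} {n : ℕ} {m : Scenario → Measure ℝ} {A : Scenario → Prop}
    (hA : ∀ᵐ ω ∂M.prob, A ω) (hm : ∀ ω, A ω → IsControl (m ω))
    (hy : ∀ ω, A ω → M.xstar ≤ y + (m ω {0}).toReal)
    (hmm : ∀ ω ω', A ω → A ω' → (m ω).restrict (Iio (min (ω n).1 (ω' n).1))
      = (m ω').restrict (Iio (min (ω n).1 (ω' n).1))) :
    M.bellman f y ≤ ∫⁻ ω, (discMass M.delta (m ω) (ω n).1 + ENNReal.ofReal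
      (Real.exp (-M.delta * (ω n).1)) * f ((ω n).2 * M.preLoss y (m ω) (ω n).1)) ∂M.prob := by
  -- follow the control of a scenario whose first event comes after time `K`, stopped at time `K`
  have hK : ∀ K : ℕ, M.bellman f y ≤ ∫⁻ ω, (discMass M.delta (m ω) (ω n).1 + ENNReal.ofReal
      (Real.exp (-M.delta * (ω n).1)) * f ((ω n).2 * M.preLoss y (m ω) (ω n).1)) ∂M.prob
      + ENNReal.ofReal (Real.exp (-M.delta * K)) * b := fun K => by
    obtain ⟨ω₀, hω₀, hA₀⟩ : ∃ ω, (K : ℝ) < (ω n).1 ∧ A ω := by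
      by_contra! hno
      have h1 : ∀ᵐ ω ∂M.prob, (ω n).1 ∉ Ici (K + 1 : ℝ) := by
        filter_upwards [hA] with ω hω h2
        rw [mem_Ici] at h2
        exact hno ω (by linarith) hω
      have h2 : ∫⁻ ω, (Ici (K + 1 : ℝ)).indicator 1 (ω n).1 ∂M.prob = 0 := by
        rw [lintegral_congr_ae (g := fun _ => 0)]
        · simp
        · filter_upwards [h1] with ω hω
          rw [indicator_of_notMem hω]
      have h3 : Measurable ((Ici (K + 1 : ℝ)).indicator (1 : ℝ → ℝ≥0∞)) :=
        measurable_one.indicator measurableSet_Ici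
      rw [M.lintegral_eval n (F := fun p => (Ici (K + 1 : ℝ)).indicator (1 : ℝ → ℝ≥0∞) p.1)
        (h3.comp measurable_fst), eventLaw, lintegral_prod (fun p : ℝ × ℝ => (Ici (K + 1 : ℝ)).indicator (1 : ℝ → ℝ≥0∞) p.1)
        (h3.comp measurable_fst).aemeasurable]
        at h2
      simp only [lintegral_const, measure_univ, mul_one] at h2
      rw [lintegral_indicator measurableSet_Ici, M.lintegral_exp_Ici (by positivity)
        measurable_one] at h2
      simp at h2
      exact absurd h2 (not_le.2 (Real.exp_pos _))
    have hc : IsControl ((m ω₀).restrict (Iic (K : ℝ))) := (hm _ hA₀).mono Measure.restrict_le_self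
    have hatom : ((m ω₀).restrict (Iic (K : ℝ))) {0} = m ω₀ {0} := by
      rw [Measure.restrict_apply (measurableSet_singleton _), inter_eq_left.2]
      simp
    refine (bellman_le f hc (by rw [hatom]; exact hy _ hA₀)).trans ?_
    rw [stepCost, ← M.lintegral_eval n (measurable_stepCost_integrand hf y _)]
    have hconst : ENNReal.ofReal (Real.exp (-M.delta * K)) * b
        = ∫⁻ _, ENNReal.ofReal (Real.exp (-M.delta * K)) * b ∂M.prob := by simp
    rw [hconst, ← lintegral_add_right _ measurable_const]
    refine lintegral_mono_ae ?_
    filter_upwards [hA, (M.measurePreserving_eval n).quasiMeasurePreserving.ae M.ae_eventLaw]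
      with ω hω hreg
    rcases le_or_gt (ω n).1 K with hle | hlt
    · refine le_add_right (le_of_eq ?_)
      have h1 : ((m ω₀).restrict (Iic (K : ℝ))).restrict (Iio (ω n).1)
          = (m ω).restrict (Iio (ω n).1) := by
        have h2 := hmm ω ω₀ hω hA₀
        rw [min_eq_left (hle.trans hω₀.le)] at h2
        rw [h2, Measure.restrict_restrict measurableSet_Iio, inter_eq_left.2]
        exact fun a (ha : a < _) => ha.le.trans hle
      rw [discMass_congr h1 le_rfl, M.preLoss_congr y h1 le_rfl]
    · rw [add_assoc]
      refine add_le_add ?_ (le_add_left ?_)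
      · have h1 : (m ω₀).restrict (Iic (K : ℝ)) = (m ω).restrict (Iic (K : ℝ)) := by
          have h2 := congrArg (fun μ => Measure.restrict μ (Iic (K : ℝ))) (hmm ω ω₀ hω hA₀)
          simp only [Measure.restrict_restrict measurableSet_Iic] at h2
          rw [inter_eq_left.2 (Iic_subset_Iio.2 (lt_min hlt hω₀))] at h2
          exact h2.symm
        rw [h1]
        exact lintegral_mono' (Measure.restrict_mono le_rfl Measure.restrict_le_self) le_rfl
      · refine mul_le_mul' (ENNReal.ofReal_le_ofReal (Real.exp_le_exp.2 ?_)) ?_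
        · nlinarith [M.delta_pos]
        · exact hfb _ (mul_preLoss_nonneg hc (by rw [hatom]; exact hy _ hA₀) hreg)
  have hlim : Tendsto (fun K : ℕ => ENNReal.ofReal (Real.exp (-M.delta * K)) * b) atTop (𝓝 0) := by
    have h1 : Tendsto (fun K : ℕ => Real.exp (-M.delta * K)) atTop (𝓝 0) :=
      Real.tendsto_exp_atBot.comp (tendsto_natCast_atTop_atTop.const_mul_atTop_of_neg
        (neg_lt_zero.2 M.delta_pos))
    have h2 := ENNReal.Tendsto.mul_const (ENNReal.tendsto_ofReal h1) (Or.inr hb)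
    simpa using h2
  have := ge_of_tendsto' (tendsto_const_nhds.add hlim) hK
  simpa using this

end CapitalModel

/-! ### The lower bound for the cost -/

namespace CapitalModel

variable {M : CapitalModel}

/-- No admissible strategy costs less than the iterates of the Bellman operator. -/
lemma valueIter_le_cost {x : ℝ} {S : Scenario → StieltjesFunction ℝ}
    (hS : M.IsAdmissible x S) (k : ℕ) : M.valueIter k x ≤ M.cost S := by
  classical
  obtain ⟨Ω, hΩm, hΩ, hΩr, hΩa, hΩn, hΩS⟩ := hS.exists_regularization
  set κ : Scenario → Measure ℝ := fun ω => if ω ∈ Ω then (S ω).measure else 0 with hκ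
  have hneg : ∀ ω, ∀ t < 0, S ω t = 0 := fun ω t ht => hS.zero_of_neg ω t ht
  have hκΩ : ∀ ω ∈ Ω, κ ω = (S ω).measure := fun ω hω => if_pos hω
  have hc : ∀ ω, IsControl (κ ω) := fun ω => by
    by_cases hω : ω ∈ Ω
    · rw [hκΩ ω hω]; exact StieltjesFunction.isControl (hneg ω)
    · simp only [hκ, hω, if_false]; exact IsControl.zero
  have hIic : ∀ t ω, κ ω (Iic t) = ENNReal.ofReal (Ω.indicator (fun ω => S ω t) ω) := fun t ω => by
    by_cases hω : ω ∈ Ω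
    · rw [hκΩ ω hω, indicator_of_mem hω, StieltjesFunction.measure_Iic_of_zero (hneg ω)]
    · simp [hκ, hω]
  have hκm : ∀ t, Measurable fun ω => κ ω (Iic t) := fun t => by
    simp only [hIic]; exact (hΩS t).ennreal_ofReal
  have h0 : ∀ ω, ω ∉ regular → κ ω = 0 := fun ω hω => if_neg fun h => hω (hΩr h)
  have hagree : ∀ ω ∈ Ω, ∀ ω' ∈ Ω, ∀ n, (∀ i < n, ω i = ω' i) →
      (κ ω).restrict (Iio (min (arrival (n + 1) ω) (arrival (n + 1) ω')))
        = (κ ω').restrict (Iio (min (arrival (n + 1) ω) (arrival (n + 1) ω'))) :=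
    fun ω hω ω' hω' n hn => (hc ω).restrict_Iio_congr fun t ht => by
      rw [lt_min_iff] at ht
      rw [hIic, hIic, indicator_of_mem hω, indicator_of_mem hω', hΩn ω hω ω' hω' n hn t ht.1 ht.2]
  have hΦm : ∀ (n : ℕ) {f : ℝ → ℝ≥0∞}, Antitone f → Measurable fun ω =>
      discMass M.delta (κ ω) (arrival n ω) + ENNReal.ofReal (Real.exp (-M.delta * arrival n ω))
        * f (M.preCapital x (κ ω) ω n) := fun n f hf => by
    have h1 := measurable_discMass_comp hκm hc M.delta (measurable_arrival n)
    have h2 := M.measurable_preCapital hκm hc h0 x n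
    have h3 := measurable_arrival n
    have h4 := hf.measurable
    fun_prop
  -- the cost up to an event plus the expected Bellman cost from then on increases with the event
  have hstep : ∀ n j, ∫⁻ ω, (discMass M.delta (κ ω) (arrival n ω)
      + ENNReal.ofReal (Real.exp (-M.delta * arrival n ω))
        * M.valueIter (j + 1) (M.preCapital x (κ ω) ω n)) ∂M.prob
      ≤ ∫⁻ ω, (discMass M.delta (κ ω) (arrival (n + 1) ω)
      + ENNReal.ofReal (Real.exp (-M.delta * arrival (n + 1) ω))
        * M.valueIter j (M.preCapital x (κ ω) ω (n + 1))) ∂M.prob := fun n j => by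
    rw [M.lintegral_splice n (hΦm n (M.valueIter_antitone (j + 1))),
      M.lintegral_splice n (hΦm (n + 1) (M.valueIter_antitone j))]
    refine lintegral_mono_ae ?_
    filter_upwards [M.ae_splice n hΩ] with ω hω
    obtain ⟨ω₀, hω₀⟩ := hω.exists
    set σ := splice n ω
    have hσn : ∀ ω', σ ω' n = ω' n := fun ω' => splice_of_le le_rfl _ _
    set τ := arrival n ω
    have hτσ : ∀ ω', arrival n (σ ω') = τ := fun ω' => arrival_splice le_rfl _ _
    have hτ' : ∀ ω', arrival (n + 1) (σ ω') = τ + (ω' n).1 := fun ω' => by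
      rw [arrival_succ, hτσ, hσn]
    have hsame : ∀ ω' ω'', ∀ i < n, σ ω' i = σ ω'' i := fun ω' ω'' i hi =>
      (splice_of_lt hi ω ω').trans (splice_of_lt hi ω ω'').symm
    have hpast : ∀ ω', σ ω' ∈ Ω → (κ (σ ω')).restrict (Iio τ) = (κ (σ ω₀)).restrict (Iio τ) :=
      fun ω' hω' => by
        refine restrict_Iio_mono ?_ (hagree _ hω' _ hω₀ n (hsame ω' ω₀))
        have h1 := strictMono_arrival (hΩr hω') (Nat.lt_succ_self n)
        have h2 := strictMono_arrival (hΩr hω₀) (Nat.lt_succ_self n)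
        simp only [hτσ] at h1 h2
        exact (lt_min h1 h2).le
    have hy : ∀ ω', σ ω' ∈ Ω → M.preCapital x (κ (σ ω')) (σ ω') n
        = M.preCapital x (κ (σ ω₀)) (σ ω₀) n := fun ω' hω' =>
      M.preCapital_congr x (hΩr hω') (hsame ω' ω₀) (by rw [hτσ]; exact hpast ω' hω')
    set y := M.preCapital x (κ (σ ω₀)) (σ ω₀) n
    have hd : ∀ ω', σ ω' ∈ Ω → discMass M.delta (κ (σ ω')) τ = discMass M.delta (κ (σ ω₀)) τ :=
      fun ω' hω' => discMass_congr (hpast ω' hω') le_rfl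
    set d := discMass M.delta (κ (σ ω₀)) τ
    have hleft : ∫⁻ ω', (discMass M.delta (κ (σ ω')) (arrival n (σ ω'))
        + ENNReal.ofReal (Real.exp (-M.delta * arrival n (σ ω')))
          * M.valueIter (j + 1) (M.preCapital x (κ (σ ω')) (σ ω') n)) ∂M.prob
        = d + ENNReal.ofReal (Real.exp (-M.delta * τ)) * M.valueIter (j + 1) y := by
      rw [lintegral_congr_ae (g := fun _ => d
        + ENNReal.ofReal (Real.exp (-M.delta * τ)) * M.valueIter (j + 1) y)]
      · simp
      · filter_upwards [hω] with ω' hω'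
        rw [hτσ, hd ω' hω', hy ω' hω']
    have hright : ∫⁻ ω', (discMass M.delta (κ (σ ω')) (arrival (n + 1) (σ ω'))
        + ENNReal.ofReal (Real.exp (-M.delta * arrival (n + 1) (σ ω')))
          * M.valueIter j (M.preCapital x (κ (σ ω')) (σ ω') (n + 1))) ∂M.prob
        = d + ENNReal.ofReal (Real.exp (-M.delta * τ))
          * ∫⁻ ω', (discMass M.delta (shiftMeasure τ (κ (σ ω'))) (ω' n).1
          + ENNReal.ofReal (Real.exp (-M.delta * (ω' n).1))
            * M.valueIter j ((ω' n).2 * M.preLoss y (shiftMeasure τ (κ (σ ω'))) (ω' n).1))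
            ∂M.prob := by
      have hconst : d = ∫⁻ _, d ∂M.prob := by simp
      conv_rhs => rw [hconst]
      rw [← lintegral_const_mul' _ _ ENNReal.ofReal_ne_top, ← lintegral_add_left measurable_const]
      refine lintegral_congr_ae ?_
      filter_upwards [hω] with ω' hω'
      rw [discMass_arrival_succ (hΩr hω'), preCapital, hτ', hτσ, hd ω' hω', hy ω' hω',
        hσn, mul_add, mul_add, Real.exp_add,
        ENNReal.ofReal_mul (Real.exp_pos _).le]
      ring
    rw [hleft, hright]
    gcongr
    refine bellman_le_lintegral (M.valueIter_antitone j).measurable ENNReal.ofReal_ne_top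
      (fun y hy => M.valueIter_le_costBound j hy) hω (fun ω' _ => (hc _).shift τ)
      (fun ω' hω' => ?_) fun ω' ω'' hω' hω'' => ?_
    · rw [shiftMeasure_singleton, ← hy ω' hω', hκΩ _ hω']
      have := hΩa _ hω' n
      rwa [M.capitalAtArrival_eq (hneg _) x (hΩr hω'), hτσ] at this
    · refine restrict_shiftMeasure_congr ?_
      have := hagree _ hω' _ hω'' n (hsame ω' ω'')
      rwa [hτ', hτ', min_add_add_left] at this
  have hiter : ∀ n j, M.valueIter (j + n) x ≤ ∫⁻ ω, (discMass M.delta (κ ω) (arrival n ω)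
      + ENNReal.ofReal (Real.exp (-M.delta * arrival n ω))
        * M.valueIter j (M.preCapital x (κ ω) ω n)) ∂M.prob := fun n => by
    induction n with
    | zero =>
      intro j
      simp [arrival_zero, preCapital]
    | succ n ih =>
      intro j
      refine le_trans ?_ (hstep n j)
      have := ih (j + 1)
      rwa [show j + 1 + n = j + (n + 1) by ring] at this
  refine (le_of_eq_of_le (by simp) (hiter k 0)).trans ?_
  rw [cost]
  refine lintegral_mono_ae ?_
  filter_upwards [hΩ] with ω hω
  simp only [valueIter, mul_zero, add_zero, hκΩ ω hω]
  exact lintegral_mono' Measure.restrict_le_self le_rfl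

/-- No admissible strategy costs less than the solution of the Bellman equation. -/
lemma bellmanValue_le_value (x : ℝ) : M.bellmanValue x ≤ M.value x :=
  iSup_le fun k => le_iInf fun S => valueIter_le_cost S.2 k

end CapitalModel

/-! ### Feedback strategies -/

/-- The cumulative transfers of a control. -/
def IsControl.stieltjes {m : Measure ℝ} (hm : IsControl m) : StieltjesFunction ℝ where
  toFun t := (m (Iic t)).toReal
  mono' _ t h := ENNReal.toReal_mono (hm.fin t) (measure_mono (Iic_subset_Iic.2 h))
  right_continuous' t := by
    rw [← continuousWithinAt_Ioi_iff_Ici]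
    have h := tendsto_measure_biInter_gt (μ := m) (s := fun r : ℝ => Iic r) (a := t)
      (fun r _ => measurableSet_Iic.nullMeasurableSet) (fun i j _ hij => Iic_subset_Iic.2 hij)
      ⟨t + 1, by simp, hm.fin _⟩
    have hI : ⋂ r > t, Iic r = Iic t := by
      ext a
      simp only [mem_iInter, mem_Iic]
      exact ⟨fun h => le_of_forall_gt_imp_ge_of_dense h, fun h r hr => h.trans (le_of_lt hr)⟩
    rw [hI] at h
    exact (ENNReal.tendsto_toReal (hm.fin t)).comp h

lemma IsControl.stieltjes_apply {m : Measure ℝ} (hm : IsControl m) (t : ℝ) :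
    hm.stieltjes t = (m (Iic t)).toReal := rfl

lemma IsControl.measure_stieltjes {m : Measure ℝ} (hm : IsControl m) : hm.stieltjes.measure = m := by
  refine Measure.ext_of_Ioc _ _ fun a b hab => ?_
  rw [StieltjesFunction.measure_Ioc, hm.stieltjes_apply, hm.stieltjes_apply, ← Iic_sdiff_Iic,
    measure_sdiff (Iic_subset_Iic.2 hab.le) measurableSet_Iic.nullMeasurableSet (hm.fin a),
    ENNReal.ofReal_sub _ ENNReal.toReal_nonneg, ENNReal.ofReal_toReal (hm.fin a),
    ENNReal.ofReal_toReal (hm.fin b)]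

namespace CapitalModel

variable (M : CapitalModel)

section Feedback

variable (c : ℕ → Measure ℝ) (i : ℝ → ℕ)

/-- The capital right after the loss event number `n` and before the transfer at that time, when
after each event the control `c (i y)` is followed, where `y` is the capital at the event. -/
def feedbackCapital (x : ℝ) (ω : Scenario) : ℕ → ℝ
  | 0 => x
  | n + 1 => (ω n).2 * M.preLoss (feedbackCapital x ω n) (c (i (feedbackCapital x ω n))) (ω n).1

/-- The control that the feedback strategy follows between the events number `n` and `n + 1`. -/
def feedbackControl (x : ℝ) (ω : Scenario) (n : ℕ) : Measure ℝ :=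
  c (i (M.feedbackCapital c i x ω n))

/-- The measure of the transfers made by the feedback strategy: the control started at each event
is cut off just before the next one. -/
def feedbackMeasure (x : ℝ) (ω : Scenario) : Measure ℝ :=
  Measure.sum fun n => delayMeasure (arrival n ω)
    ((M.feedbackControl c i x ω n).restrict (Iio (ω n).1))

/-- The discounted transfers of the feedback strategy before the event number `n`. -/
def feedbackCost (x : ℝ) (n : ℕ) (ω : Scenario) : ℝ≥0∞ :=
  ∑ k ∈ Finset.range n, ENNReal.ofReal (Real.exp (-M.delta * arrival k ω))
    * discMass M.delta (M.feedbackControl c i x ω k) (ω k).1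

variable {M c i}

lemma feedbackCapital_congr (x : ℝ) {ω ω' : Scenario} {n : ℕ} (h : ∀ j < n, ω j = ω' j) :
    M.feedbackCapital c i x ω n = M.feedbackCapital c i x ω' n := by
  induction n with
  | zero => rfl
  | succ n ih =>
    rw [feedbackCapital, feedbackCapital, ih fun j hj => h j (by omega), h n (Nat.lt_succ_self n)]

lemma feedbackControl_congr (x : ℝ) {ω ω' : Scenario} {n : ℕ} (h : ∀ j < n, ω j = ω' j) :
    M.feedbackControl c i x ω n = M.feedbackControl c i x ω' n := by
  rw [feedbackControl, feedbackCapital_congr x h, feedbackControl]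

lemma feedbackCost_congr (x : ℝ) {ω ω' : Scenario} {n : ℕ} (h : ∀ j < n, ω j = ω' j) :
    M.feedbackCost c i x n ω = M.feedbackCost c i x n ω' := by
  refine Finset.sum_congr rfl fun k hk => ?_
  have hk := Finset.mem_range.1 hk
  rw [arrival_congr fun j hj => h j (by omega), feedbackControl_congr x fun j hj => h j (by omega),
    h k hk]

lemma feedbackMeasure_apply (x : ℝ) (ω : Scenario) {A : Set ℝ} (hA : MeasurableSet A) :
    M.feedbackMeasure c i x ω A
      = ∑' n, M.feedbackControl c i x ω n ((fun a => a + arrival n ω) ⁻¹' A ∩ Iio (ω n).1) := by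
  rw [feedbackMeasure, Measure.sum_apply _ hA]
  congr 1; ext n
  rw [delayMeasure, Measure.map_apply (by fun_prop) hA, Measure.restrict_apply
    (hA.preimage (by fun_prop))]

lemma isControl_feedbackMeasure (hc : ∀ j, IsControl (c j)) (x : ℝ) {ω : Scenario}
    (hω : ω ∈ regular) : IsControl (M.feedbackMeasure c i x ω) := by
  have hcut : ∀ n, IsControl (delayMeasure (arrival n ω)
      ((M.feedbackControl c i x ω n).restrict (Iio (ω n).1))) := fun n =>
    ((hc _).mono Measure.restrict_le_self).delay (arrival_nonneg hω n)
  refine ⟨?_, fun t => ?_⟩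
  · rw [feedbackMeasure, Measure.sum_apply _ measurableSet_Iio, ENNReal.tsum_eq_zero]
    exact fun n => (hcut n).neg
  · obtain ⟨k, hk⟩ := exists_nat_gt t
    obtain ⟨N, hN⟩ := hω.2 k
    rw [feedbackMeasure, Measure.sum_apply _ measurableSet_Iic, tsum_eq_sum (s := Finset.range N)]
    · exact ENNReal.sum_ne_top.2 fun n _ => (hcut n).fin t
    · intro n hn
      have hle := (strictMono_arrival hω).monotone (not_lt.1 (fun h => hn (Finset.mem_range.2 h)))
      rw [delayMeasure, Measure.map_apply (by fun_prop) measurableSet_Iic]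
      refine measure_mono_null (fun a ha => ?_) ((hc (i (M.feedbackCapital c i x ω n))).mono
        (Measure.restrict_le_self (s := Iio (ω n).1))).neg
      simp only [mem_preimage, mem_Iic, mem_Iio] at ha ⊢
      linarith

/-- Between two events the feedback strategy follows the control chosen at the first one. -/
lemma shift_feedbackMeasure (hc : ∀ j, IsControl (c j)) (x : ℝ) {ω : Scenario} (hω : ω ∈ regular)
    (n : ℕ) : (shiftMeasure (arrival n ω) (M.feedbackMeasure c i x ω)).restrict (Iio (ω n).1)
      = (M.feedbackControl c i x ω n).restrict (Iio (ω n).1) := by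
  ext A hA
  have hs := strictMono_arrival hω
  have hA' : MeasurableSet ((fun a => a - arrival n ω) ⁻¹' (A ∩ Iio (ω n).1) ∩ Ici (arrival n ω)) :=
    ((hA.inter measurableSet_Iio).preimage (by fun_prop)).inter measurableSet_Ici
  rw [Measure.restrict_apply hA, Measure.restrict_apply hA, shiftMeasure,
    Measure.map_apply (by fun_prop) (hA.inter measurableSet_Iio),
    Measure.restrict_apply ((hA.inter measurableSet_Iio).preimage (by fun_prop)),
    feedbackMeasure_apply x ω hA', tsum_eq_single n]
  · have hneg : M.feedbackControl c i x ω n (Iio 0) = 0 := (hc _).neg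
    refine measure_congr ?_
    have : ∀ᵐ a ∂(M.feedbackControl c i x ω n), a ∉ Iio 0 := measure_eq_zero_iff_ae_notMem.1 hneg
    filter_upwards [this] with a ha
    refine propext ?_
    change (((a + arrival n ω - arrival n ω ∈ A ∧ a + arrival n ω - arrival n ω < (ω n).1)
      ∧ arrival n ω ≤ a + arrival n ω) ∧ a < (ω n).1) ↔ (a ∈ A ∧ a < (ω n).1)
    have : 0 ≤ a := not_lt.1 ha
    rw [add_sub_cancel_right]
    constructor
    · rintro ⟨⟨h1, -⟩, -⟩; exact h1
    · rintro h1; exact ⟨⟨h1, by linarith⟩, h1.2⟩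
  · intro k hk
    have hneg : M.feedbackControl c i x ω k (Iio 0) = 0 := (hc _).neg
    refine measure_mono_null ?_ hneg
    rintro a ⟨⟨⟨-, h1⟩, h2⟩, h3⟩
    simp only [mem_Iio, mem_Ici] at h1 h2 h3 ⊢
    rcases lt_or_gt_of_ne hk with hk | hk
    · have := hs.monotone (show k + 1 ≤ n from hk)
      simp only [arrival_succ] at this
      linarith
    · have := hs.monotone (show n + 1 ≤ k from hk)
      simp only [arrival_succ] at this
      linarith

lemma preCapital_feedbackMeasure (hc : ∀ j, IsControl (c j)) (x : ℝ) {ω : Scenario}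
    (hω : ω ∈ regular) (n : ℕ) :
    M.preCapital x (M.feedbackMeasure c i x ω) ω n = M.feedbackCapital c i x ω n := by
  induction n with
  | zero => rfl
  | succ n ih =>
    rw [preCapital, feedbackCapital, ih,
      M.preLoss_congr _ (shift_feedbackMeasure hc x hω n) le_rfl, feedbackControl]

lemma feedbackMeasure_singleton (hc : ∀ j, IsControl (c j)) (x : ℝ) {ω : Scenario}
    (hω : ω ∈ regular) (n : ℕ) : M.feedbackMeasure c i x ω {arrival n ω}
      = c (i (M.feedbackCapital c i x ω n)) {0} := by
  have h := congrArg (fun μ : Measure ℝ => μ {0}) (shift_feedbackMeasure (M := M) (i := i) hc x hω n)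
  have hw : (0 : ℝ) < (ω n).1 := (hω.1 n).1
  have h0 : ({0} : Set ℝ) ∩ Iio (ω n).1 = {0} := inter_eq_left.2 (by simpa using hw)
  simp only [Measure.restrict_apply (measurableSet_singleton (0 : ℝ)), h0,
    shiftMeasure_singleton] at h
  exact h

lemma feedbackCapital_nonneg (hc : ∀ j, IsControl (c j))
    (hi : ∀ y, 0 ≤ y → M.xstar ≤ y + (c (i y) {0}).toReal) {x : ℝ} (hx : 0 ≤ x) {ω : Scenario}
    (hω : ω ∈ regular) (n : ℕ) : 0 ≤ M.feedbackCapital c i x ω n := by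
  induction n with
  | zero => exact hx
  | succ n ih => exact mul_preLoss_nonneg (hc _) (hi _ ih) (hω.1 n)

lemma discMass_feedbackMeasure (hc : ∀ j, IsControl (c j)) (x : ℝ) {ω : Scenario}
    (hω : ω ∈ regular) (n : ℕ) : discMass M.delta (M.feedbackMeasure c i x ω) (arrival n ω)
      = M.feedbackCost c i x n ω := by
  induction n with
  | zero => simp [arrival_zero, discMass, feedbackCost]
  | succ n ih =>
    rw [discMass_arrival_succ hω, ih, feedbackCost, feedbackCost, Finset.sum_range_succ,
      discMass_congr (shift_feedbackMeasure hc x hω n) le_rfl]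

/-- The scenario seen at time `t`: the events after time `t` are hidden. -/
def clip (t : ℝ) (ω : Scenario) : Scenario := fun j =>
  ((if arrival (j + 1) ω ≤ t then arrival (j + 1) ω else t + 1)
      - (if j = 0 then 0 else if arrival j ω ≤ t then arrival j ω else t + 1),
    if arrival (j + 1) ω ≤ t then proportion j ω else 0)

lemma measurable_clip (t : ℝ) : @Measurable _ _ (rawHistory t) _ (clip t) := by
  have hgen : ∀ (n : ℕ) (φ : ℝ × ℝ → ℝ), Measurable φ → ∀ b : ℝ, @Measurable _ _ (rawHistory t) _
      fun ω => if arrival (n + 1) ω ≤ t then φ (arrival (n + 1) ω, proportion n ω) else b := by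
    intro n φ hφ b A hA
    have hset : ∀ B, MeasurableSet B → MeasurableSet[rawHistory t]
        {ω | arrival (n + 1) ω ≤ t ∧ (arrival (n + 1) ω, proportion n ω) ∈ B} := fun B hB =>
      MeasurableSpace.measurableSet_generateFrom ⟨n, B, hB, rfl⟩
    have h1 := hset _ (hφ hA)
    have h2 := hset _ MeasurableSet.univ
    by_cases hb : b ∈ A
    · have : (fun ω => if arrival (n + 1) ω ≤ t then φ (arrival (n + 1) ω, proportion n ω) else b)
          ⁻¹' A = {ω | arrival (n + 1) ω ≤ t ∧ (arrival (n + 1) ω, proportion n ω) ∈ φ ⁻¹' A}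
            ∪ {ω | arrival (n + 1) ω ≤ t ∧ (arrival (n + 1) ω, proportion n ω) ∈ univ}ᶜ := by
        ext ω
        by_cases h : arrival (n + 1) ω ≤ t <;> simp [h, hb]
      rw [this]
      exact @MeasurableSet.union _ (rawHistory t) _ _ h1 (@MeasurableSet.compl _ _ (rawHistory t) h2)
    · have : (fun ω => if arrival (n + 1) ω ≤ t then φ (arrival (n + 1) ω, proportion n ω) else b)
          ⁻¹' A = {ω | arrival (n + 1) ω ≤ t ∧ (arrival (n + 1) ω, proportion n ω) ∈ φ ⁻¹' A} := by
        ext ω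
        by_cases h : arrival (n + 1) ω ≤ t <;> simp [h, hb]
      rw [this]
      exact h1
  refine @measurable_pi_lambda _ _ _ (rawHistory t) _ _ fun j => ?_
  simp only [clip]
  refine Measurable.prodMk ?_ ?_
  · refine Measurable.sub (hgen j Prod.fst measurable_fst _) ?_
    cases j with
    | zero => simp
    | succ j => simpa using hgen j Prod.fst measurable_fst (t + 1)
  · exact hgen j Prod.snd measurable_snd 0

lemma arrival_clip (t : ℝ) (ω : Scenario) (n : ℕ) : arrival n (clip t ω)
    = if n = 0 then 0 else if arrival n ω ≤ t then arrival n ω else t + 1 := by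
  induction n with
  | zero => simp [arrival_zero]
  | succ n ih => rw [arrival_succ, ih, clip]; simp

lemma clip_eq_of_le {t : ℝ} {ω : Scenario} (hω : ω ∈ regular) {j : ℕ}
    (h : arrival (j + 1) ω ≤ t) : clip t ω j = ω j := by
  have h1 : arrival j ω ≤ t := ((strictMono_arrival hω) (Nat.lt_succ_self j)).le.trans h
  have h2 := arrival_succ j ω
  rw [clip]
  simp only [h, h1, if_true]
  ext
  · rcases Nat.eq_zero_or_pos j with rfl | hj
    · simp [arrival_succ, arrival_zero]
    · simp only [hj.ne', if_false]; linarith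
  · rfl

/-- The transfers of the feedback strategy up to time `t` depend only on the events up to time `t`,
which makes the strategy adapted. -/
lemma feedbackMeasure_clip (hc : ∀ j, IsControl (c j)) (x : ℝ) {t : ℝ} (ht : 0 ≤ t) {ω : Scenario}
    (hω : ω ∈ regular) : M.feedbackMeasure c i x (clip t ω) (Iic t)
      = M.feedbackMeasure c i x ω (Iic t) := by
  rw [feedbackMeasure_apply _ _ measurableSet_Iic, feedbackMeasure_apply _ _ measurableSet_Iic]
  congr 1; ext n
  have hτ := arrival_clip t ω n
  by_cases hn : arrival n ω ≤ t
  · have hagree : ∀ j < n, clip t ω j = ω j := fun j hj => clip_eq_of_le hω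
      (((strictMono_arrival hω).monotone (show j + 1 ≤ n from hj)).trans hn)
    rw [feedbackControl_congr x hagree, arrival_congr hagree]
    by_cases hn1 : arrival (n + 1) ω ≤ t
    · rw [clip_eq_of_le hω hn1]
    · have h1 : t < arrival n ω + (ω n).1 := by rw [← arrival_succ]; exact not_le.1 hn1
      have h2 : t < arrival n ω + (clip t ω n).1 := by
        rw [← arrival_congr hagree, ← arrival_succ, arrival_clip]
        simp [hn1]
      congr 1
      ext a
      simp only [mem_inter_iff, mem_preimage, mem_Iic, mem_Iio]
      constructor <;> rintro ⟨h3, -⟩ <;> exact ⟨h3, by linarith⟩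
  · have hn0 : n ≠ 0 := by rintro rfl; rw [arrival_zero] at hn; exact hn ht
    rw [if_neg hn0, if_neg hn] at hτ
    have hz : ∀ (s : ℝ) (B : Set ℝ) (j : ℕ), t < s → c j ((fun a => a + s) ⁻¹' Iic t ∩ B) = 0 :=
      fun s B j hs => measure_mono_null (fun a ha => by
        have := ha.1
        simp only [mem_preimage, mem_Iic, mem_Iio] at this ⊢
        linarith) (hc j).neg
    rw [feedbackControl, feedbackControl, hz _ _ _ (not_le.1 hn), hz _ _ _ (by rw [hτ]; linarith)]

lemma measurable_discMass_index (c : ℕ → Measure ℝ) (k : ℝ) :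
    Measurable fun p : ℕ × ℝ => discMass k (c p.1) p.2 :=
  measurable_from_prod_countable_right fun j => measurable_discMass k (c j)

lemma measurable_feedbackCapital (hi : Measurable i) (x : ℝ) (n : ℕ) :
    Measurable fun ω => M.feedbackCapital c i x ω n := by
  induction n with
  | zero => exact measurable_const
  | succ n ih =>
    have h1 := (measurable_discMass_index c M.r).comp ((hi.comp ih).prodMk
      (measurable_fst.comp (measurable_pi_apply (X := fun _ : ℕ => ℝ × ℝ) n)))
    simp only [feedbackCapital, preLoss]
    simp only [Function.comp_def] at h1
    fun_prop

lemma measurable_feedbackCost (hi : Measurable i) (x : ℝ) (n : ℕ) :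
    Measurable (M.feedbackCost c i x n) := by
  unfold feedbackCost
  refine Finset.measurable_sum _ fun k _ => ?_
  have h1 := (measurable_discMass_index c M.delta).comp
    ((hi.comp (measurable_feedbackCapital (M := M) (c := c) hi x k)).prodMk
      (measurable_fst.comp (measurable_pi_apply (X := fun _ : ℕ => ℝ × ℝ) k)))
  have h2 := measurable_arrival k
  simp only [Function.comp_def] at h1
  unfold feedbackControl
  fun_prop

lemma measurable_feedbackMeasure_Iic (hc : ∀ j, IsControl (c j)) (hi : Measurable i) (x t : ℝ) :
    Measurable fun ω => M.feedbackMeasure c i x ω (Iic t) := by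
  simp only [feedbackMeasure_apply _ _ measurableSet_Iic]
  refine Measurable.tsum fun n => ?_
  have h1 : Measurable fun p : ℕ × (ℝ × ℝ) => c p.1 ((fun a => a + p.2.1) ⁻¹' Iic t ∩ Iio p.2.2) := by
    refine measurable_from_prod_countable_right fun j => ?_
    have := (hc j).sFinite
    have hs : MeasurableSet ({q : (ℝ × ℝ) × ℝ | q.2 + q.1.1 ≤ t} ∩ {q | q.2 < q.1.2}) :=
      (measurableSet_le (by fun_prop) measurable_const).inter
        (measurableSet_lt (by fun_prop) (by fun_prop))
    exact measurable_measure_prodMk_left (ν := c j) hs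
  have h2 := measurable_feedbackCapital (M := M) (c := c) hi x n
  have h3 := measurable_arrival n
  exact h1.comp ((hi.comp h2).prodMk (h3.prodMk (by fun_prop)))

end Feedback

end CapitalModel

/-! ### The cost of feedback strategies -/

namespace CapitalModel

variable {M : CapitalModel}

open Classical in
/-- The feedback strategy as a path of cumulative transfers; it is zero off the regular scenarios,
where the transfers may fail to be locally finite. -/
def feedbackStrategy (M : CapitalModel) {c : ℕ → Measure ℝ} (hc : ∀ j, IsControl (c j)) (i : ℝ → ℕ)
    (x : ℝ) (ω : Scenario) : StieltjesFunction ℝ :=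
  if hω : ω ∈ regular then
    (isControl_feedbackMeasure (M := M) (i := i) hc x hω).stieltjes
  else 0

section

variable {c : ℕ → Measure ℝ} {i : ℝ → ℕ} {x : ℝ}

lemma feedbackStrategy_apply (hc : ∀ j, IsControl (c j)) {ω : Scenario} (hω : ω ∈ regular) (t : ℝ) :
    M.feedbackStrategy hc i x ω t = (M.feedbackMeasure c i x ω (Iic t)).toReal := by
  rw [feedbackStrategy, dif_pos hω, IsControl.stieltjes_apply]

lemma measure_feedbackStrategy (hc : ∀ j, IsControl (c j)) {ω : Scenario} (hω : ω ∈ regular) :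
    (M.feedbackStrategy hc i x ω).measure = M.feedbackMeasure c i x ω := by
  rw [feedbackStrategy, dif_pos hω, IsControl.measure_stieltjes]

lemma isAdmissible_feedbackStrategy (hc : ∀ j, IsControl (c j)) (hi : Measurable i)
    (hci : ∀ y, 0 ≤ y → M.xstar ≤ y + (c (i y) {0}).toReal) (hx : 0 ≤ x) :
    M.IsAdmissible x (M.feedbackStrategy hc i x) := by
  have hneg : ∀ ω t, t < 0 → M.feedbackStrategy hc i x ω t = 0 := fun ω t ht => by
    by_cases hω : ω ∈ regular
    · rw [feedbackStrategy_apply hc hω, measure_mono_null (Iic_subset_Iio.2 ht)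
        (isControl_feedbackMeasure hc x hω).neg, ENNReal.toReal_zero]
    · rw [feedbackStrategy, dif_neg hω]; rfl
  refine ⟨hneg, fun t ht => ?_, ?_⟩
  · have h1 : @Measurable _ _ (rawHistory t) _
        fun ω => (M.feedbackMeasure c i x (clip t ω) (Iic t)).toReal :=
      ((measurable_feedbackMeasure_Iic hc hi x t).comp (measurable_clip t)).ennreal_toReal
    refine h1.eventuallyMeasurable_of_eventuallyEq (l := ae M.prob) ?_
    filter_upwards [M.ae_regular] with ω hω
    rw [feedbackStrategy_apply hc hω, feedbackMeasure_clip hc x ht hω]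
  · filter_upwards [M.ae_regular] with ω hω
    rw [forall_xstar_le_capital_iff _ _ _ hω]
    intro n
    rw [M.capitalAtArrival_eq (hneg ω) x hω, measure_feedbackStrategy hc hω,
      preCapital_feedbackMeasure hc x hω, feedbackMeasure_singleton hc x hω]
    exact hci _ (feedbackCapital_nonneg hc hci hx hω n)

lemma cost_feedbackStrategy_le (hc : ∀ j, IsControl (c j)) :
    M.cost (M.feedbackStrategy hc i x) ≤ ∫⁻ ω, ⨆ n, M.feedbackCost c i x n ω ∂M.prob := by
  refine lintegral_mono_ae ?_
  filter_upwards [M.ae_regular] with ω hω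
  have hm := isControl_feedbackMeasure (M := M) (i := i) hc x hω
  rw [measure_feedbackStrategy hc hω]
  have hI : Ici (0 : ℝ) = ⋃ n, Ico 0 (arrival n ω) := by
    ext a
    simp only [mem_Ici, mem_iUnion, mem_Ico]
    constructor
    · intro ha
      obtain ⟨n, -, hn⟩ := exists_arrival hω ha
      exact ⟨n + 1, ha, hn⟩
    · rintro ⟨n, ha, -⟩; exact ha
  have hae : ∀ᵐ a ∂M.feedbackMeasure c i x ω, a ∈ Ici (0 : ℝ) := by
    rw [ae_iff]; simpa [Iio] using hm.neg
  rw [← Measure.restrict_eq_self_of_ae_mem hae, hI, setLIntegral_iUnion_of_directed _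
    (directed_of_isDirected_le fun m n hmn => Ico_subset_Ico_right
      ((strictMono_arrival hω).monotone hmn))]
  exact iSup_mono fun n => (discMass_feedbackMeasure hc x hω n).le

/-- The expected cost up to an event plus the Bellman value from then on can increase at each event
by no more than the discounted loss of optimality. -/
lemma lintegral_feedbackCost_succ_le (hc : ∀ j, IsControl (c j)) (hi : Measurable i)
    (hci : ∀ y, 0 ≤ y → M.xstar ≤ y + (c (i y) {0}).toReal) (hx : 0 ≤ x) {e : ℝ≥0∞}
    (he : ∀ y, 0 ≤ y → M.stepCost M.bellmanValue y (c (i y)) ≤ M.bellmanValue y + e) (n : ℕ) :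
    ∫⁻ ω, (M.feedbackCost c i x (n + 1) ω + ENNReal.ofReal (Real.exp (-M.delta * arrival (n + 1) ω))
        * M.bellmanValue (M.feedbackCapital c i x ω (n + 1))) ∂M.prob
      ≤ ∫⁻ ω, (M.feedbackCost c i x n ω + ENNReal.ofReal (Real.exp (-M.delta * arrival n ω))
        * M.bellmanValue (M.feedbackCapital c i x ω n)) ∂M.prob
        + ENNReal.ofReal M.discount ^ n * e := by
  have hU := M.bellmanValue_antitone.measurable
  have h1 := fun n => measurable_feedbackCost (M := M) (c := c) hi x n
  have h2 := fun n => measurable_feedbackCapital (M := M) (c := c) hi x n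
  have h3 := measurable_arrival
  rw [M.lintegral_splice n (by fun_prop), ← lintegral_discount_arrival,
    ← lintegral_mul_const _ (by fun_prop), ← lintegral_add_right _ (by fun_prop)]
  refine lintegral_mono_ae ?_
  filter_upwards [M.ae_regular] with ω hω
  have hs : ∀ ω', ∀ j < n, splice n ω ω' j = ω j := fun ω' j hj => splice_of_lt hj _ _
  set y := M.feedbackCapital c i x ω n with hy
  have hinner : ∀ ω', M.feedbackCost c i x (n + 1) (splice n ω ω')
      + ENNReal.ofReal (Real.exp (-M.delta * arrival (n + 1) (splice n ω ω')))
        * M.bellmanValue (M.feedbackCapital c i x (splice n ω ω') (n + 1))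
      = M.feedbackCost c i x n ω + ENNReal.ofReal (Real.exp (-M.delta * arrival n ω))
        * (discMass M.delta (c (i y)) (ω' n).1 + ENNReal.ofReal (Real.exp (-M.delta * (ω' n).1))
          * M.bellmanValue ((ω' n).2 * M.preLoss y (c (i y)) (ω' n).1)) := fun ω' => by
    have hcost : M.feedbackCost c i x (n + 1) (splice n ω ω') = M.feedbackCost c i x n ω
        + ENNReal.ofReal (Real.exp (-M.delta * arrival n ω))
          * discMass M.delta (c (i y)) (ω' n).1 := by
      rw [← feedbackCost_congr x (hs ω'), feedbackCost, feedbackCost, Finset.sum_range_succ,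
        arrival_congr (hs ω'), feedbackControl_congr x (hs ω'), splice_of_le le_rfl,
        feedbackControl]
    rw [hcost, arrival_succ, arrival_congr (hs ω'), feedbackCapital, feedbackCapital_congr x (hs ω'),
      splice_of_le le_rfl, ← hy, mul_add (-M.delta), Real.exp_add,
      ENNReal.ofReal_mul (Real.exp_pos _).le]
    ring
  simp only [hinner]
  have hmeas := measurable_stepCost_integrand (M := M) hU y (c (i y))
  rw [lintegral_add_left measurable_const, lintegral_const_mul' _ _ ENNReal.ofReal_ne_top,
    M.lintegral_eval n hmeas, add_assoc, ← mul_add]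
  simp only [lintegral_const, measure_univ, mul_one]
  gcongr
  exact he y (feedbackCapital_nonneg hc hci hx hω n)

lemma value_le_of_feedback (hc : ∀ j, IsControl (c j)) (hi : Measurable i)
    (hci : ∀ y, 0 ≤ y → M.xstar ≤ y + (c (i y) {0}).toReal) (hx : 0 ≤ x) {e : ℝ≥0∞}
    (he : ∀ y, 0 ≤ y → M.stepCost M.bellmanValue y (c (i y)) ≤ M.bellmanValue y + e) :
    M.value x ≤ M.bellmanValue x + (1 - ENNReal.ofReal M.discount)⁻¹ * e := by
  have hiter : ∀ n, ∫⁻ ω, (M.feedbackCost c i x n ω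
      + ENNReal.ofReal (Real.exp (-M.delta * arrival n ω))
        * M.bellmanValue (M.feedbackCapital c i x ω n)) ∂M.prob
      ≤ M.bellmanValue x + (∑ k ∈ Finset.range n, ENNReal.ofReal M.discount ^ k) * e := fun n => by
    induction n with
    | zero => simp [feedbackCost, arrival_zero, feedbackCapital]
    | succ n ih =>
      rw [Finset.sum_range_succ, add_mul, ← add_assoc]
      exact (lintegral_feedbackCost_succ_le hc hi hci hx he n).trans (by gcongr)
  refine (iInf_le (fun S : {S // M.IsAdmissible x S} => M.cost S.1)
    ⟨_, isAdmissible_feedbackStrategy hc hi hci hx⟩).trans ((cost_feedbackStrategy_le hc).trans ?_)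
  rw [lintegral_iSup (fun n => measurable_feedbackCost hi x n)]
  · refine iSup_le fun n => ?_
    calc ∫⁻ ω, M.feedbackCost c i x n ω ∂M.prob ≤ _ := lintegral_mono fun ω => le_self_add
      _ ≤ _ := hiter n
      _ ≤ _ := by
        gcongr
        rw [← ENNReal.tsum_geometric]
        exact ENNReal.sum_le_tsum _
  · intro m n hmn ω
    exact Finset.sum_le_sum_of_subset (Finset.range_subset_range.2 hmn)

end

/-- The value function is the solution of the Bellman equation. For the upper bound, after each
event an `ε`-optimal control is followed for the largest multiple of `ε` below the capital. -/
lemma value_eq_bellmanValue {x : ℝ} (hx : 0 ≤ x) : M.value x = M.bellmanValue x := by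
  refine le_antisymm (ENNReal.le_of_forall_pos_le_add fun η hη _ => ?_) (bellmanValue_le_value x)
  have hd : 0 < 1 - M.discount := sub_pos.2 M.discount_lt_one
  have hη' : (0 : ℝ) < η := hη
  obtain ⟨ε, hε, hεη⟩ : ∃ ε : ℝ, 0 < ε ∧ (1 - M.discount)⁻¹ * (ε + ε) = η :=
    ⟨(1 - M.discount) * η / 2, by positivity, by field_simp; ring⟩
  have hex : ∀ j : ℕ, ∃ m, (IsControl m ∧ M.xstar ≤ j * ε + (m {0}).toReal) ∧
      M.stepCost M.bellmanValue (j * ε) m ≤ M.bellmanValue (j * ε) + ENNReal.ofReal ε := fun j => by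
    have hlt : M.bellman M.bellmanValue (j * ε) < M.bellmanValue (j * ε) + ENNReal.ofReal ε := by
      rw [M.bellman_bellmanValue]
      exact ENNReal.lt_add_right (M.bellmanValue_ne_top (by positivity)) (by simpa using hε)
    simp only [bellman, iInf_lt_iff] at hlt
    obtain ⟨m, hm, hlt⟩ := hlt
    exact ⟨m, hm, hlt.le⟩
  choose c hc hce using hex
  have hi : Measurable fun y : ℝ => ⌊y / ε⌋₊ := Nat.measurable_floor.comp (by fun_prop)
  have hfloor : ∀ y, 0 ≤ y → (⌊y / ε⌋₊ : ℝ) * ε ≤ y := fun y hy =>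
    (le_div_iff₀ hε).1 (Nat.floor_le (by positivity))
  refine (value_le_of_feedback (e := ENNReal.ofReal ε + ENNReal.ofReal ε) (fun j => (hc j).1) hi
    (fun y hy => (hc _).2.trans (by gcongr; exact hfloor y hy)) hx fun y hy => ?_).trans ?_
  · refine (stepCost_anti M.bellmanValue_antitone (hfloor y hy) _).trans ((hce _).trans ?_)
    have h1 := M.bellmanValue_le_ofReal_add ((⌊y / ε⌋₊ : ℝ) * ε) (sub_nonneg.2 (hfloor y hy))
    rw [add_sub_cancel] at h1
    have h2 : ENNReal.ofReal (y - (⌊y / ε⌋₊ : ℝ) * ε) ≤ ENNReal.ofReal ε := by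
      refine ENNReal.ofReal_le_ofReal ?_
      have := (div_lt_iff₀ hε).1 (Nat.lt_floor_add_one (y / ε))
      linarith
    rw [← add_assoc, add_comm (M.bellmanValue y)]
    gcongr
    exact h1.trans (by gcongr)
  · gcongr
    rw [← ENNReal.ofReal_one, ← ENNReal.ofReal_sub _ M.discount_pos.le, ← ENNReal.ofReal_inv_of_pos hd,
      ← ENNReal.ofReal_add hε.le hε.le, ← ENNReal.ofReal_mul (by positivity), hεη,
      ENNReal.ofReal_coe_nnreal]

end CapitalModel

end

theorem proposition3p2 (M : CapitalModel) :
    (∀ x : ℝ, 0 ≤ x → M.value x ≠ ⊤) ∧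
      M.IsViscositySolution (fun x => (M.value x).toReal) := by
  have hreal : ∀ x, 0 ≤ x → (M.value x).toReal = M.realValue x := fun x hx => by
    rw [CapitalModel.value_eq_bellmanValue hx, CapitalModel.realValue]
  have hpos : ∀ x, M.xstar ≤ x → 0 ≤ x := fun x hx => M.xstar_pos.le.trans hx
  have hlip : LocallyLipschitzOn (Ici M.xstar) fun x => (M.value x).toReal := by
    refine fun z _ => ⟨1, Ici M.xstar, self_mem_nhdsWithin, fun x hx y hy => ?_⟩
    simp only
    rw [hreal x (hpos x hx), hreal y (hpos y hy)]
    exact M.lipschitzOnWith_realValue (hpos x hx) (hpos y hy)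
  refine ⟨fun x hx => ?_, hlip, fun x hx => ⟨⟨hlip, fun ψ hψ heq hmin => ?_⟩,
    ⟨hlip, fun φ hφ heq hmax => ?_⟩⟩⟩
  · rw [CapitalModel.value_eq_bellmanValue hx]
    exact M.bellmanValue_ne_top hx
  · refine M.realValue_subsolution hx hψ (heq.trans (hreal x (hpos x hx.le))) fun y hy => ?_
    have := isMinOn_iff.1 hmin y hy
    rw [← hreal y (hpos y hy)]
    linarith
  · refine M.realValue_supersolution hx hφ (heq.trans (hreal x (hpos x hx.le))) fun y hy => ?_
    have := isMaxOn_iff.1 hmax y hy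
    rw [← hreal y (hpos y hy)]
    linarith
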